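/- Let $R$ be a finite set of faces of one of the following two lattices in the plane: the unit squares $[i,i+1]\times[j,j+1]$ with $i,j\in\mathbb Z$ (quadriculated case), or the unit equilateral triangles of the triangular lattice (triangulated case). A tile is the union of two faces with a common side (a domino, resp. a lozenge), and a tiling of $R$ is a partition of the faces of $R$ into tiles. A site is a $2\times2$ square of four faces, resp. a hexagon formed by the six triangles around a lattice point; a site has exactly two tilings. A flip of a tiling $t$ at a site that is filled by tiles of $t$ (two dominoes, resp. three lozenges) replaces these tiles by the other tiling of the site. Two sites are disjoint if they have no face in common. Let $T$ be the graph whose vertices are the tilings of $R$ and whose edges join tilings that differ by a flip. Let $\mathcal T$ be the CW complex with vertex set the set of tilings of $R$, with one $k$-cell, a cube $[0,1]^k$, for every set of $2^k$ tilings obtained from one tiling by performing all subfamilies of a family of $k$ flips at pairwise disjoint sites ($k\ge 0$); these tilings are the corners of the cube, each coordinate of the cube corresponds to one of the $k$ sites, and each cube is glued along its facets to the cubes of the families with one flip fewer. Thus the 1-skeleton of $\mathcal T$ is $T$. Theorem 3.3. Suppose that the union of the closed faces in $R$ is a simply connected subset of the plane and that $R$ has at least one tiling. Then: 1. $\mathcal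 T$ is contractible. 2. For all tilings $t,t'$ of $R$, any two geodesics in $T$ from $t$ to $t'$ (paths with the minimal number of flips) are equivalent, that is, each can be transformed into the other by finitely many exchanges of the order of two successive flips at disjoint sites. 3. Every closed curve in $\mathcal T$ is null-homotopic: every loop based at a point $x$ of $\mathcal T$ is homotopic, relative to its endpoints, to the constant loop at $x$. -/

import Mathlib

namespace FlipComplex

/-- The combinatorial data of a lattice of unit faces in the plane `ℂ`, of the tiles made of
two adjacent faces, and of the places where a flip can be made. Only the two concrete systems
`quadriculated` and `triangulated` below are used. -/
structure TileSystem where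
  /-- the unit faces of the plane -/
  Face : Type
  [decEqFace : DecidableEq Face]
  /-- the closed polygon in the plane occupied by a face -/
  polygon : Face → Set ℂ
  /-- the tiles, as sets of faces -/
  IsTile : Finset Face → Prop
  /-- the places where flips happen (squares of side 2, resp. unit hexagons) -/
  Site : Type
  [decEqSite : DecidableEq Site]
  /-- the two ways to fill a site with tiles -/
  filling : Site → Bool → Finset (Finset Face)

attribute [instance] TileSystem.decEqFace TileSystem.decEqSite

/-- Unit squares and dominoes. The face `(i, j)` is `[i, i+1] × [j, j+1]`. The site `(i, j)` is
the square `[i, i+2] × [j, j+2]`, filled by two horizontal (`false`) or two vertical (`true`)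
dominoes; these two fillings are rotations of each other by 90°. -/
abbrev quadriculated : TileSystem where
  Face := ℤ × ℤ
  polygon f := Set.Icc (f.1 : ℝ) (f.1 + 1) ×ℂ Set.Icc (f.2 : ℝ) (f.2 + 1)
  IsTile d := ∃ i j : ℤ, d = {(i, j), (i + 1, j)} ∨ d = {(i, j), (i, j + 1)}
  Site := ℤ × ℤ
  filling s b := match b with
    | false => {{(s.1, s.2), (s.1 + 1, s.2)}, {(s.1, s.2 + 1), (s.1 + 1, s.2 + 1)}}
    | true => {{(s.1, s.2), (s.1, s.2 + 1)}, {(s.1 + 1, s.2), (s.1 + 1, s.2 + 1)}}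

/-- The point `x + y ω` of the plane, where `ω = exp(iπ/3) = 1/2 + (√3/2) i`. -/
noncomputable def oblique (p : ℝ × ℝ) : ℂ := p.1 + p.2 * ⟨1 / 2, √3 / 2⟩

/-- Unit equilateral triangles and lozenges. Write `v i j = i + j ω`. The face `(i, j, true)` is
the triangle with vertices `v i j`, `v (i+1) j`, `v i (j+1)`; the face `(i, j, false)` is the
triangle with vertices `v (i+1) j`, `v i (j+1)`, `v (i+1) (j+1)`. A lozenge consists of two
triangles with a common side. The site `(i, j)` is the hexagon of the six triangles around
`v i j`; its two fillings by three lozenges are rotations of each other by 60°. -/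
noncomputable abbrev triangulated : TileSystem where
  Face := ℤ × ℤ × Bool
  polygon f := oblique '' (match f with
    | (i, j, true) => {p | (i : ℝ) ≤ p.1 ∧ (j : ℝ) ≤ p.2 ∧ p.1 + p.2 ≤ i + j + 1}
    | (i, j, false) => {p | p.1 ≤ (i : ℝ) + 1 ∧ p.2 ≤ (j : ℝ) + 1 ∧ (i : ℝ) + j + 1 ≤ p.1 + p.2})
  IsTile d := ∃ i j : ℤ, d = {(i, j, true), (i, j, false)} ∨
    d = {(i, j, true), (i - 1, j, false)} ∨ d = {(i, j, true), (i, j - 1, false)}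
  Site := ℤ × ℤ
  filling s b := match b with
    | false => {{(s.1, s.2, true), (s.1 - 1, s.2, false)},
        {(s.1 - 1, s.2, true), (s.1 - 1, s.2 - 1, false)},
        {(s.1, s.2 - 1, true), (s.1, s.2 - 1, false)}}
    | true => {{(s.1 - 1, s.2, true), (s.1 - 1, s.2, false)},
        {(s.1, s.2 - 1, true), (s.1 - 1, s.2 - 1, false)},
        {(s.1, s.2, true), (s.1, s.2 - 1, false)}}

/-- The two kinds of planar regions. -/
inductive Lattice
  | quad
  | tri

/-- The tile system of a lattice: dominoes on squares, lozenges on triangles. -/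
noncomputable def Lattice.system : Lattice → TileSystem
  | .quad => quadriculated
  | .tri => triangulated

variable (L : TileSystem)

/-- The subset of the plane covered by finitely many faces. -/
def carrier (R : Finset L.Face) : Set ℂ := ⋃ f ∈ R, L.polygon f

/-- A tiling of the region `R`: tiles contained in `R`, such that every face of `R` lies in
exactly one of them. -/
@[ext]
structure Tiling (R : Finset L.Face) where
  tiles : Finset (Finset L.Face)
  isTile : ∀ d ∈ tiles, L.IsTile d
  subset : ∀ d ∈ tiles, d ⊆ R
  cover : ∀ f ∈ R, ∃! d, d ∈ tiles ∧ f ∈ d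

/-- The set of faces of a site. -/
def support (s : L.Site) : Finset L.Face := (L.filling s false).biUnion id

variable {L} {R : Finset L.Face}

/-- `t'` is obtained from `t` by a flip at `s`: the tiles of `t` filling `s` are lifted and
replaced by the tiles of the other filling of `s`. -/
def IsFlip (s : L.Site) (t t' : Tiling L R) : Prop :=
  ∃ b : Bool, L.filling s b ⊆ t.tiles ∧
    t'.tiles = (t.tiles \ L.filling s b) ∪ L.filling s (!b)

variable (L R)

/-- The graph of tilings: two tilings are adjacent iff they differ by a flip. -/
def flipGraph : SimpleGraph (Tiling L R) := SimpleGraph.fromRel fun t t' => ∃ s, IsFlip s t t'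

/-- A cell (cube) of the flip complex: a family of flips of a tiling at pairwise disjoint sites.
Performing any subfamily of these flips gives the corners of the cube. To have every cube
exactly once, it is recorded by its corner where all its sites carry the filling `false`. -/
structure Cell where
  corner : Tiling L R
  sites : Finset L.Site
  flippable : ∀ s ∈ sites, L.filling s false ⊆ corner.tiles
  independent : (sites : Set L.Site).PairwiseDisjoint (support L)

/-- The disjoint union of the cubes `[0,1]^k`, one for each cell with `k` sites. -/
abbrev Cubes : Type := Σ c : Cell L R, (c.sites → unitInterval)

variable {L R}

/-- The gluing of a cube to its codimension-one faces. The face where the coordinate at the site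
`s` is `0` is the cube on the remaining sites with the same corner; the face where it is `1` is
the cube on the remaining sites whose corner is flipped at `s`. -/
def Glue (p q : Cubes L R) : Prop :=
  ∃ (s : L.Site) (hs : s ∈ p.1.sites),
    q.1.sites = p.1.sites.erase s ∧
    (∀ (r : L.Site) (hr : r ∈ p.1.sites) (hr' : r ∈ q.1.sites), q.2 ⟨r, hr'⟩ = p.2 ⟨r, hr⟩) ∧
    ((p.2 ⟨s, hs⟩ = 0 ∧ q.1.corner = p.1.corner) ∨
      (p.2 ⟨s, hs⟩ = 1 ∧ IsFlip s p.1.corner q.1.corner))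

variable (L R)

/-- The flip complex: the quotient space of the disjoint union of the cubes by the gluing of
every cube to its faces. Its 1-skeleton is the graph of tilings, and it has one `k`-cell for
every cube of `k` pairwise disjoint flips. -/
abbrev Complex : Type := Quot (Glue (L := L) (R := R))

variable {L R}

/-- A walk in the graph of tilings is a geodesic if it has the minimal number of flips among
all walks with the same ends. -/
def IsGeodesic {t t' : Tiling L R} (p : (flipGraph L R).Walk t t') : Prop :=
  p.length = (flipGraph L R).dist t t'

/-- `q` is obtained from `p` by changing the order of two successive flips which act on disjoint
sites. -/
def Swap {t t' : Tiling L R} (p q : (flipGraph L R).Walk t t') : Prop :=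
  ∃ (a u u' c : Tiling L R) (p₁ : (flipGraph L R).Walk t a) (p₂ : (flipGraph L R).Walk c t')
    (h₁ : (flipGraph L R).Adj a u) (h₂ : (flipGraph L R).Adj u c)
    (h₁' : (flipGraph L R).Adj a u') (h₂' : (flipGraph L R).Adj u' c) (r s : L.Site),
    Disjoint (support L r) (support L s) ∧
    IsFlip r a u ∧ IsFlip s u c ∧ IsFlip s a u' ∧ IsFlip r u' c ∧
    p = p₁.append (.cons h₁ (.cons h₂ p₂)) ∧
    q = p₁.append (.cons h₁' (.cons h₂' p₂))

/-- Equivalence of walks: the equivalence relation generated by exchanging two successive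
disjoint flips. -/
def Equivalent {t t' : Tiling L R} (p q : (flipGraph L R).Walk t t') : Prop :=
  Relation.EqvGen Swap p q

end FlipComplex

/-! Take the sites as vertices of a planar graph whose regions are the faces, coloured black and
white, and direct each edge with black on its left. Every face is then bounded by a directed cycle,
so cochains can be summed around faces without signs. A tiling becomes a 0/1 function on the edges
(those which its tiles straddle) with sum 1 around each face of `R` and sum 0 around the others. The
difference of two tilings is therefore closed, hence the coboundary of an integer function on the
vertices. If `R` has no holes, this function can be normalised to vanish at all vertices not
interior to `R`: it is the height of one tiling relative to the other (`NoHoles.exists_height`).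
Heights are characterised by inequalities between adjacent values (`IsHeight.exists_tiling`), so
they are closed under minimum and maximum, and a flip is a change by one at a single vertex
(`isFlip_iff`).

The topology of the region enters once. Outside the region a point `z₀` admits a branch of `log (z -
z₀)` on the region; comparing it with principal logarithms gives, for each face off `R`, a cochain
winding around that face and vanishing on the edges of `R` (`noHoles_of_simplyConnected`).

The combinatorial core is `exists_up_flip`: if one height is somewhere below another, it can be
raised by a flip at a vertex where it is below. Hence flip distance is the `ℓ¹` distance of heights
(`dist_eq_heightDist`). Different flips that begin geodesics to the same tiling act on disjoint
sites (`disjoint_of_heightDist`), and completing them to a square proves by induction that geodesics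
are equivalent.

For contractibility, the affine extension of the heights embeds the complex in the space of real
functions on the vertices (`complexHomeomorph`). The image is closed under pointwise minimum and
contains a path from its greatest to its least element; the minimum with a point moving along this
path is a contraction. Null-homotopy of loops follows. -/

/-! ### Branches of the logarithm on finite unions of closed convex sets -/

/-- A small ball around `x` misses every `C i` that does not contain `x`, so the union is
star-shaped about `x` inside the ball. Local path connectedness is what lifting through the covering
`exp` requires. -/
theorem locallyPathConnectedSpace_biUnion_of_convex {ι : Type*} (s : Finset ι) (C : ι → Set ℂ)
    (hconv : ∀ i ∈ s, Convex ℝ (C i)) (hclosed : ∀ i ∈ s, IsClosed (C i)) :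
    LocallyPathConnectedSpace (⋃ i ∈ s, C i : Set ℂ) := by
  classical
  refine ⟨fun x => Filter.hasBasis_self.2 fun U hU => ?_⟩
  obtain ⟨ε, hε, hεU⟩ := Metric.mem_nhds_iff.1 hU
  have hK : IsClosed (⋃ i ∈ s.filter (fun i => x.1 ∉ C i), C i) :=
    (Finset.finite_toSet _).isClosed_biUnion fun i hi =>
      hclosed i (Finset.mem_filter.1 (Finset.mem_coe.1 hi)).1
  have hxK : x.1 ∈ (⋃ i ∈ s.filter (fun i => x.1 ∉ C i), C i)ᶜ := by
    simp
  obtain ⟨δ, hδ, hδK⟩ := Metric.isOpen_iff.1 hK.isOpen_compl _ hxK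
  refine ⟨Metric.ball x (min ε δ), Metric.ball_mem_nhds _ (lt_min hε hδ), ?_,
    (Metric.ball_subset_ball (min_le_left _ _)).trans hεU⟩
  rw [Topology.IsInducing.subtypeVal.isPathConnected_iff]
  have himg : (Subtype.val '' Metric.ball x (min ε δ) : Set ℂ) =
      (⋃ i ∈ s, C i) ∩ Metric.ball x.1 (min ε δ) := by
    ext z
    constructor
    · rintro ⟨y, hy, rfl⟩
      exact ⟨y.2, hy⟩
    · rintro ⟨h1, h2⟩
      exact ⟨⟨z, h1⟩, h2, rfl⟩
  rw [himg]
  refine StarConvex.isPathConnected (a := x.1) ?_ ⟨x.2, Metric.mem_ball_self (lt_min hε hδ)⟩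
  rw [starConvex_iff_segment_subset]
  rintro z ⟨hz, hzb⟩
  refine Set.subset_inter ?_ ((convex_ball x.1 _).segment_subset
    (Metric.mem_ball_self (lt_min hε hδ)) hzb)
  obtain ⟨i, hi, hzi⟩ := Set.mem_iUnion₂.1 hz
  have hxi : x.1 ∈ C i := by
    by_contra hxi
    exact hδK (Metric.ball_subset_ball (min_le_right _ _) hzb)
      (Set.mem_iUnion₂.2 ⟨i, Finset.mem_filter.2 ⟨hi, hxi⟩, hzi⟩)
  exact ((hconv i hi).segment_subset hxi hzi).trans (Set.subset_biUnion_of_mem hi)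

theorem exists_continuous_log_sub {S : Set ℂ} [SimplyConnectedSpace S]
    [LocallyPathConnectedSpace S] {z₀ : ℂ} (hz : z₀ ∉ S) :
    ∃ F : C(S, ℂ), ∀ z : S, Complex.exp (F z) = z - z₀ := by
  have hne : ∀ z : S, (z : ℂ) - z₀ ≠ 0 := fun z h => hz (sub_eq_zero.1 h ▸ z.2)
  have a : S := Classical.arbitrary S
  obtain ⟨F, ⟨-, hF⟩, -⟩ := Complex.isCoveringMapOn_exp.existsUnique_continuousMap_lifts
    (⟨fun z : S => (z : ℂ) - z₀, by fun_prop⟩ : C(S, ℂ)) (a₀ := a)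
    (e₀ := Complex.log (a - z₀)) (Complex.exp_log (hne a)) hne
  exact ⟨F, fun z => congrFun hF z⟩

/-- The number is `(a + s (b - a) - z₀) / (a - z₀)`. If it were a nonpositive real, `z₀` would lie
on the segment, at parameter `-1 / q`. -/
theorem one_add_mul_mem_slitPlane {a b z₀ : ℂ} (h : z₀ ∉ segment ℝ a b) {s : ℝ} (hs : 0 ≤ s)
    (hs1 : s ≤ 1) : 1 + s * ((b - a) / (a - z₀)) ∈ Complex.slitPlane := by
  have ha : a - z₀ ≠ 0 := fun h0 => h (sub_eq_zero.1 h0 ▸ left_mem_segment ℝ a b)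
  rw [Complex.mem_slitPlane_iff_not_le_zero]
  intro hle
  set q := (b - a) / (a - z₀) with hq
  obtain ⟨hre, him⟩ := Complex.le_def.1 hle
  simp only [Complex.add_re, Complex.one_re, Complex.re_ofReal_mul, Complex.zero_re,
    Complex.add_im, Complex.one_im, Complex.im_ofReal_mul, Complex.zero_im, zero_add] at hre him
  have hs0 : s ≠ 0 := by
    rintro rfl
    norm_num at hre
  have hqi : q.im = 0 := by simpa [hs0] using him
  have hqr : q.re ≤ -1 := by
    by_contra! hc
    nlinarith [lt_of_le_of_ne hs (Ne.symm hs0)]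
  have hqe : q = (q.re : ℂ) := Complex.ext rfl (by simp [hqi])
  have hba : b - a = q.re * (a - z₀) := by
    rw [← hqe, hq]
    field_simp
  apply h
  refine segment_eq_image' ℝ a b ▸ ⟨-(1 / q.re), ⟨?_, ?_⟩, ?_⟩
  · have : 1 / q.re ≤ 0 := div_nonpos_of_nonneg_of_nonpos zero_le_one (by linarith)
    linarith
  · have : -(1 / q.re) = 1 / (-q.re) := by rw [div_neg]
    rw [this, div_le_one (by linarith)]
    linarith
  · have hqc : (q.re : ℂ) ≠ 0 := by
      exact_mod_cast (by linarith : q.re ≠ 0)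
    simp only [hba, Complex.real_smul]
    push_cast
    field_simp
    ring

/-- Along the segment, `F` and the principal logarithm (whose argument stays in the slit plane) are
two lifts of one path through `exp` with the same start, so they agree at the end. -/
theorem log_sub_eq_of_segment_subset {S : Set ℂ} {z₀ : ℂ} (hz : z₀ ∉ S) (F : C(S, ℂ))
    (hF : ∀ z : S, Complex.exp (F z) = z - z₀) {a b : S} (hab : segment ℝ (a : ℂ) b ⊆ S) :
    F b - F a = Complex.log ((b - z₀) / (a - z₀)) := by
  have ha : (a : ℂ) - z₀ ≠ 0 := fun h => hz (sub_eq_zero.1 h ▸ a.2)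
  have hseg : z₀ ∉ segment ℝ (a : ℂ) b := fun h => hz (hab h)
  have hmem : ∀ s : unitInterval, (a : ℂ) + (s : ℝ) * ((b : ℂ) - a) ∈ S := fun s => hab <| by
    rw [segment_eq_image']
    exact ⟨s, s.2, by simp⟩
  set g₁ : unitInterval → ℂ := fun s => F ⟨_, hmem s⟩ with hg₁
  set g₂ : unitInterval → ℂ := fun s =>
    F a + Complex.log (1 + (s : ℝ) * (((b : ℂ) - a) / (a - z₀))) with hg₂
  have hc₁ : Continuous g₁ := by
    refine F.continuous.comp (Continuous.subtype_mk ?_ _)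
    fun_prop
  have hc₂ : Continuous g₂ := by
    refine continuous_const.add (Continuous.clog (by fun_prop) fun s => ?_)
    exact one_add_mul_mem_slitPlane hseg s.2.1 s.2.2
  have hcomp : (fun z : ℂ ↦ (⟨_, z.exp_ne_zero⟩ : {z : ℂ // z ≠ 0})) ∘ g₁ =
      (fun z : ℂ ↦ (⟨_, z.exp_ne_zero⟩ : {z : ℂ // z ≠ 0})) ∘ g₂ := by
    funext s
    refine Subtype.ext ?_
    simp only [Function.comp, hg₁, hg₂, hF, Complex.exp_add]
    rw [Complex.exp_log
      (Complex.slitPlane_ne_zero (one_add_mul_mem_slitPlane hseg s.2.1 s.2.2))]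
    field_simp
    ring
  have h0 : g₁ 0 = g₂ 0 := by simp [hg₁, hg₂]
  have h1 := congrFun (Complex.isCoveringMap_exp.eq_of_comp_eq hc₁ hc₂ hcomp 0 h0) 1
  simp only [hg₁, hg₂, Set.Icc.coe_one, Complex.ofReal_one, one_mul, add_sub_cancel,
    Subtype.coe_eta] at h1
  rw [h1, add_sub_cancel_left]
  congr 1
  field_simp
  ring

/-! ### Planar models and regions without holes -/

namespace FlipComplex

/-- A description of a tile system by a planar graph drawn on the sites: its vertices are the sites,
its regions are the faces, coloured black and white, its edges are directed so that the black face
is on the left. Every tile is obtained by joining the two faces along an edge, and the two fillings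
of a site join the faces along the edges which leave the site, resp. arrive there. -/
structure PlanarModel (L : TileSystem) where
  E : Type
  [decEqE : DecidableEq E]
  src : E → L.Site
  tgt : E → L.Site
  left : E → L.Face
  right : E → L.Face
  black : L.Face → Prop
  deg : ℕ
  bdry : L.Face → Finset E
  out : L.Site → Finset E
  up : L.Site → Bool
  pos : L.Site → ℂ
  center : L.Face → ℂ
  infinite : Infinite L.Site
  black_left : ∀ e, black (left e)
  not_black_right : ∀ e, ¬ black (right e)
  mem_bdry : ∀ {e f}, e ∈ bdry f ↔ left e = f ∨ right e = f
  card_bdry : ∀ f, (bdry f).card = deg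
  deg_pos : 0 < deg
  mem_out : ∀ {e v}, e ∈ out v ↔ src e = v
  out_nonempty : ∀ v, (out v).Nonempty
  src_ne_tgt : ∀ e, src e ≠ tgt e
  edge_ext : ∀ {e e'}, left e = left e' → right e = right e' → e = e'
  isTile_iff : ∀ {d}, L.IsTile d ↔ ∃ e, d = {left e, right e}
  mem_filling_up : ∀ {s d}, d ∈ L.filling s (up s) ↔ ∃ e, src e = s ∧ d = {left e, right e}
  mem_filling_not_up : ∀ {s d},
    d ∈ L.filling s (!up s) ↔ ∃ e, tgt e = s ∧ d = {left e, right e}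
  star : ∀ {v f}, (∃ e, src e = v ∧ (left e = f ∨ right e = f)) ↔
    ∃ e, tgt e = v ∧ (left e = f ∨ right e = f)
  sum_coboundary : ∀ {G : Type} [AddCommGroup G] (K : L.Site → G) (f : L.Face),
    ∑ e ∈ bdry f, (K (tgt e) - K (src e)) = 0
  exists_potential : ∀ {G : Type} [AddCommGroup G] (φ : E → G),
    (∀ f, ∑ e ∈ bdry f, φ e = 0) → ∃ K : L.Site → G, ∀ e, K (tgt e) - K (src e) = φ e
  const_of_coboundary_eq_zero : ∀ {G : Type} (K : L.Site → G),
    (∀ e, K (tgt e) = K (src e)) → ∀ v w, K v = K w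
  const_on_face : ∀ {G : Type} (K : L.Site → G) (f : L.Face),
    (∀ e ∈ bdry f, K (tgt e) = K (src e)) → ∃ k, ∀ e ∈ bdry f, K (src e) = k
  const_off_finite : ∀ {G : Type} (K : L.Site → G) (R : Finset L.Face),
    (∀ e, ¬ (left e ∈ R ∧ right e ∈ R) → K (tgt e) = K (src e)) → ∃ k, {v | K v ≠ k}.Finite
  convex_polygon : ∀ f, Convex ℝ (L.polygon f)
  isClosed_polygon : ∀ f, IsClosed (L.polygon f)
  src_mem_polygon : ∀ {e f}, e ∈ bdry f → pos (src e) ∈ L.polygon f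
  tgt_mem_polygon : ∀ {e f}, e ∈ bdry f → pos (tgt e) ∈ L.polygon f
  center_notMem_polygon : ∀ {f f'}, f ≠ f' → center f ∉ L.polygon f'
  rotation : ∀ f, ∃ r : ℂ, r ≠ 0 ∧ r ≠ 1 ∧
    ∀ e ∈ bdry f, (pos (tgt e) - center f) / (pos (src e) - center f) = r

attribute [instance] PlanarModel.decEqE

variable {L : TileSystem} (M : PlanarModel L) {R : Finset L.Face}

/-- The set of faces `R` has no holes, in cohomological form: around every face outside `R`,
there is a cochain winding once around this face which vanishes on the edges of `R`. -/
def PlanarModel.NoHoles (R : Finset L.Face) : Prop :=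
  ∀ f₀ ∉ R, ∃ w : M.E → ℂ, (∀ e, M.left e ∈ R ∨ M.right e ∈ R → w e = 0) ∧
    ∀ f, ∑ e ∈ M.bdry f, w e = if f = f₀ then 1 else 0

namespace PlanarModel

theorem exists_log_cochain (z₀ : ℂ) (R : Finset L.Face) [SimplyConnectedSpace (carrier L R)]
    (hz : z₀ ∉ carrier L R) : ∃ K : L.Site → ℂ, ∀ f ∈ R, ∀ e ∈ M.bdry f,
      K (M.tgt e) - K (M.src e) =
        Complex.log ((M.pos (M.tgt e) - z₀) / (M.pos (M.src e) - z₀)) := by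
  classical
  have : LocallyPathConnectedSpace (carrier L R) :=
    locallyPathConnectedSpace_biUnion_of_convex R L.polygon (fun f _ => M.convex_polygon f)
      (fun f _ => M.isClosed_polygon f)
  obtain ⟨F, hF⟩ := exists_continuous_log_sub hz
  -- The value 0 off the region is immaterial: both ends of an edge of a face of `R` lie in the
  -- region.
  refine ⟨fun v => if h : M.pos v ∈ carrier L R then F ⟨M.pos v, h⟩ else 0, fun f hf e he => ?_⟩
  have hsub : L.polygon f ⊆ carrier L R := Set.subset_biUnion_of_mem (u := L.polygon) hf
  have hs := hsub (M.src_mem_polygon he)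
  have ht := hsub (M.tgt_mem_polygon he)
  beta_reduce
  rw [dif_pos hs, dif_pos ht]
  exact log_sub_eq_of_segment_subset hz F hF (a := ⟨_, hs⟩) (b := ⟨_, ht⟩)
    (((M.convex_polygon f).segment_subset (M.src_mem_polygon he) (M.tgt_mem_polygon he)).trans hsub)

/-- The principal logarithms of the ratios at consecutive vertices, seen from the centre of `f₀`,
add up to `deg * log r ≠ 0` around `f₀`, because every edge of `f₀` turns by the same ratio `r`.
Subtracting the coboundary of a logarithm on the region kills the edges of `R` and changes no sum
around a face. -/
theorem noHoles_of_simplyConnected [SimplyConnectedSpace (carrier L R)] : M.NoHoles R := by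
  intro f₀ hf₀
  have hz : M.center f₀ ∉ carrier L R := by
    intro h
    obtain ⟨f, hf, hz⟩ := Set.mem_iUnion₂.1 h
    exact M.center_notMem_polygon (fun h : f₀ = f => hf₀ (h ▸ hf)) hz
  obtain ⟨K, hK⟩ := M.exists_log_cochain _ R hz
  obtain ⟨r, hr0, hr1, hr⟩ := M.rotation f₀
  have hlog : Complex.log r ≠ 0 := fun h => hr1 (by rw [← Complex.exp_log hr0, h, Complex.exp_zero])
  have hc : (M.deg : ℂ) * Complex.log r ≠ 0 :=
    mul_ne_zero (Nat.cast_ne_zero.2 M.deg_pos.ne') hlog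
  set z₀ := M.center f₀
  refine ⟨fun e => (M.deg * Complex.log r)⁻¹ *
    (Complex.log ((M.pos (M.tgt e) - z₀) / (M.pos (M.src e) - z₀)) -
      (K (M.tgt e) - K (M.src e))), ?_, fun f => ?_⟩
  · rintro e (he | he) <;> beta_reduce
    · rw [hK _ he e (M.mem_bdry.2 (Or.inl rfl)), sub_self, mul_zero]
    · rw [hK _ he e (M.mem_bdry.2 (Or.inr rfl)), sub_self, mul_zero]
  · rw [← Finset.mul_sum, Finset.sum_sub_distrib, M.sum_coboundary, sub_zero]
    split_ifs with hf
    · subst hf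
      rw [Finset.sum_congr rfl fun e he => by rw [hr e he], Finset.sum_const, M.card_bdry,
        nsmul_eq_mul, inv_mul_cancel₀ hc]
    -- A face other than `f₀` is convex and misses the centre, so it carries its own logarithm and
    -- the increments around it cancel.
    · have hcar : carrier L {f} = L.polygon f := by simp [carrier]
      have hne : (L.polygon f).Nonempty := by
        obtain ⟨e, he⟩ := Finset.card_pos.1 (M.card_bdry f ▸ M.deg_pos)
        exact ⟨_, M.src_mem_polygon he⟩
      have := (M.convex_polygon f).contractibleSpace hne
      rw [← hcar] at this
      obtain ⟨K', hK'⟩ := M.exists_log_cochain z₀ {f}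
        (hcar ▸ M.center_notMem_polygon (Ne.symm hf))
      rw [Finset.sum_congr rfl fun e he => (hK' f (Finset.mem_singleton_self f) e he).symm,
        M.sum_coboundary, mul_zero]

end PlanarModel
-- Potentials and locally constant functions on the integer grid
section IntegerGrid

variable {G : Type}

theorem exists_discrete_primitive [AddCommGroup G] (a : ℤ → G) : ∃ A : ℤ → G, ∀ i, A (i + 1) - A i = a i := by
  refine ⟨fun n => match n with
    | Int.ofNat n => ∑ k ∈ Finset.range n, a k
    | Int.negSucc n => -∑ k ∈ Finset.range (n + 1), a (-1 - k), fun i => ?_⟩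
  match i with
  | Int.ofNat n =>
    change ∑ k ∈ Finset.range (n + 1), a k - _ = _
    simp [Finset.sum_range_succ]
  | Int.negSucc 0 =>
    change ∑ k ∈ Finset.range 0, a k - _ = _
    simp
  | Int.negSucc (n + 1) =>
    change -∑ k ∈ Finset.range (n + 1), a (-1 - k) - -∑ k ∈ Finset.range (n + 1 + 1), a (-1 - k) = _
    rw [Finset.sum_range_succ _ (n + 1)]
    have : Int.negSucc (n + 1) = -1 - ((n + 1 : ℕ) : ℤ) := by
      rw [Int.negSucc_eq]
      push_cast
      ring
    rw [this]
    abel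

/-- Exactness of closed cochains on the grid: integrate along the horizontal axis, then vertically.
The hypothesis, closedness around each unit square, carries the horizontal increments from row to
row. -/
theorem exists_grid_potential [AddCommGroup G] (h v : ℤ → ℤ → G)
    (hv : ∀ i j, h i j + v (i + 1) j = v i j + h i (j + 1)) :
    ∃ K : ℤ → ℤ → G, (∀ i j, K (i + 1) j - K i j = h i j) ∧ ∀ i j, K i (j + 1) - K i j = v i j := by
  obtain ⟨A, hA⟩ := exists_discrete_primitive fun i => h i 0
  choose B hB using fun i => exists_discrete_primitive (v i)
  refine ⟨fun i j => A i + (B i j - B i 0), fun i j => ?_, fun i j => ?_⟩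
  · induction j using Int.induction_on with
    | zero => simp [hA]
    | succ n ih =>
      have h1 := hB i n
      have h2 := hB (i + 1) n
      rw [sub_eq_iff_eq_add] at h1 h2
      have h3 := hv i n
      rw [← ih] at h3
      beta_reduce at h3 ⊢
      rw [h1, h2, ← add_right_inj (v i n), ← h3]
      abel
    | pred n ih =>
      have h1 := hB i (-n - 1)
      have h2 := hB (i + 1) (-n - 1)
      have h3 := hv i (-n - 1)
      rw [sub_add_cancel] at h1 h2 h3
      rw [sub_eq_iff_eq_add'] at h1 h2
      beta_reduce at ih ⊢
      rw [h1, h2] at ih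
      rw [← ih] at h3
      rw [eq_comm, ← add_left_inj (v (i + 1) (-n - 1)), h3]
      abel
  · simp [hB]

theorem eq_zero_of_succ_eq {f : ℤ → G} (hf : ∀ n, f (n + 1) = f n) (n : ℤ) : f n = f 0 := by
  induction n using Int.induction_on with
  | zero => rfl
  | succ n ih => rw [hf, ih]
  | pred n ih => rw [← ih, ← hf (-n - 1), sub_add_cancel]

theorem eq_of_succ_eq {f : ℤ → G} (hf : ∀ n, f (n + 1) = f n) (m n : ℤ) : f m = f n := by
  rw [eq_zero_of_succ_eq hf, eq_zero_of_succ_eq hf n]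

/-- A point outside the box lies on a full row or column outside the box; this line meets the column
or row with index `N + 1`, which leads to `(N + 1, N + 1)`. -/
theorem grid_const_off_box (K : ℤ × ℤ → G) (N : ℤ)
    (h : ∀ i j, N < |i| ∨ N < |j| → K (i + 1, j) = K (i, j) ∧ K (i, j + 1) = K (i, j)) :
    ∃ k, {v | K v ≠ k}.Finite := by
  refine ⟨K (N + 1, N + 1), ((Set.finite_Icc (-N) N).prod (Set.finite_Icc (-N) N)).subset ?_⟩
  rintro ⟨i, j⟩ hK
  by_contra hb
  have hN : N < |N + 1| := lt_of_lt_of_le (lt_add_one N) (le_abs_self _)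
  have hij : N < |i| ∨ N < |j| := by
    simp only [Set.mem_prod, Set.mem_Icc, ← abs_le] at hb
    by_contra! hc
    exact hb hc
  refine hK ?_
  rcases hij with hi | hj
  · rw [eq_of_succ_eq (f := fun j => K (i, j)) (fun j => (h i j (Or.inl hi)).2) j (N + 1)]
    exact eq_of_succ_eq (f := fun i => K (i, N + 1)) (fun i => (h i _ (Or.inr hN)).1) i (N + 1)
  · rw [eq_of_succ_eq (f := fun i => K (i, j)) (fun i => (h i j (Or.inr hj)).1) i (N + 1)]
    exact eq_of_succ_eq (f := fun j => K (N + 1, j)) (fun j => (h _ j (Or.inl hN)).2) j (N + 1)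

theorem grid_const (K : ℤ × ℤ → G) (h₁ : ∀ i j, K (i + 1, j) = K (i, j))
    (h₂ : ∀ i j, K (i, j + 1) = K (i, j)) (v w : ℤ × ℤ) : K v = K w := by
  obtain ⟨i, j⟩ := v
  obtain ⟨i', j'⟩ := w
  rw [eq_of_succ_eq (f := fun i => K (i, j)) (fun i => h₁ i j) i i']
  exact eq_of_succ_eq (f := fun j => K (i', j)) (fun j => h₂ i' j) j j'

end IntegerGrid

/-! ### The planar model of squares and dominoes -/

namespace Quad

/-- The flag is `true` for the horizontal edge from the site `(i, j)` to `(i + 1, j)` and `false`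
for the vertical one to `(i, j + 1)`. The site `(i, j)` is the lattice point `(i + 1, j + 1)`, the
centre of its 2 × 2 square, whence the shifts in `left` and `right`. Black faces have even
coordinate sum, so directions alternate with the parity of `i + j`; the edges leaving a site are
both horizontal or both vertical. -/
abbrev Edge : Type := ℤ × ℤ × Bool

def src : Edge → ℤ × ℤ
  | (i, j, true) => if (i + j) % 2 = 0 then (i, j) else (i + 1, j)
  | (i, j, false) => if (i + j) % 2 = 0 then (i, j + 1) else (i, j)

def tgt : Edge → ℤ × ℤ
  | (i, j, true) => if (i + j) % 2 = 0 then (i + 1, j) else (i, j)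
  | (i, j, false) => if (i + j) % 2 = 0 then (i, j) else (i, j + 1)

def left : Edge → ℤ × ℤ
  | (i, j, true) => if (i + j) % 2 = 0 then (i + 1, j + 1) else (i + 1, j)
  | (i, j, false) => if (i + j) % 2 = 0 then (i + 1, j + 1) else (i, j + 1)

def right : Edge → ℤ × ℤ
  | (i, j, true) => if (i + j) % 2 = 0 then (i + 1, j) else (i + 1, j + 1)
  | (i, j, false) => if (i + j) % 2 = 0 then (i, j + 1) else (i + 1, j + 1)

def bdry (f : ℤ × ℤ) : Finset Edge :=
  {(f.1 - 1, f.2 - 1, true), (f.1 - 1, f.2, true), (f.1 - 1, f.2 - 1, false), (f.1, f.2 - 1, false)}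

def out (s : ℤ × ℤ) : Finset Edge :=
  if (s.1 + s.2) % 2 = 0 then {(s.1 - 1, s.2, true), (s.1, s.2, true)}
  else {(s.1, s.2 - 1, false), (s.1, s.2, false)}

def inn (s : ℤ × ℤ) : Finset Edge :=
  if (s.1 + s.2) % 2 = 0 then {(s.1, s.2 - 1, false), (s.1, s.2, false)}
  else {(s.1 - 1, s.2, true), (s.1, s.2, true)}

theorem mem_bdry {e : Edge} {f : ℤ × ℤ} : e ∈ bdry f ↔ left e = f ∨ right e = f := by
  obtain ⟨i, j, _ | _⟩ := e <;> obtain ⟨a, b⟩ := f <;> by_cases h : (i + j) % 2 = 0 <;>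
    simp [bdry, left, right, h, Prod.ext_iff] <;> omega

theorem mem_out {e : Edge} {s : ℤ × ℤ} : e ∈ out s ↔ src e = s := by
  obtain ⟨i, j, _ | _⟩ := e <;> obtain ⟨a, b⟩ := s <;> by_cases h : (i + j) % 2 = 0 <;>
    by_cases h' : (a + b) % 2 = 0 <;> simp [out, src, h, h', Prod.ext_iff] <;> omega

theorem mem_inn {e : Edge} {s : ℤ × ℤ} : e ∈ inn s ↔ tgt e = s := by
  obtain ⟨i, j, _ | _⟩ := e <;> obtain ⟨a, b⟩ := s <;> by_cases h : (i + j) % 2 = 0 <;>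
    by_cases h' : (a + b) % 2 = 0 <;> simp [inn, tgt, h, h', Prod.ext_iff] <;> omega

theorem sum_bdry {G : Type} [AddCommGroup G] (g : Edge → G) (a b : ℤ) :
    ∑ e ∈ bdry (a, b), g e = g (a - 1, b - 1, true) + (g (a - 1, b, true) +
      (g (a - 1, b - 1, false) + g (a, b - 1, false))) := by
  rw [bdry, Finset.sum_insert, Finset.sum_insert, Finset.sum_insert, Finset.sum_singleton] <;>
    simp

theorem tile_horizontal (i j : ℤ) : ({left (i, j, true), right (i, j, true)} : Finset (ℤ × ℤ)) =
    {(i + 1, j), (i + 1, j + 1)} := by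
  by_cases h : (i + j) % 2 = 0 <;> simp [left, right, h, Finset.pair_comm]

theorem tile_vertical (i j : ℤ) : ({left (i, j, false), right (i, j, false)} : Finset (ℤ × ℤ)) =
    {(i, j + 1), (i + 1, j + 1)} := by
  by_cases h : (i + j) % 2 = 0 <;> simp [left, right, h, Finset.pair_comm]

theorem star_out {v f : ℤ × ℤ} : (∃ e, src e = v ∧ (left e = f ∨ right e = f)) ↔
    (f.1 = v.1 ∨ f.1 = v.1 + 1) ∧ (f.2 = v.2 ∨ f.2 = v.2 + 1) := by
  obtain ⟨a, b⟩ := f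
  obtain ⟨i, j⟩ := v
  simp only [← mem_out]
  by_cases h : (i + j) % 2 = 0
  · have h' : ¬ (i - 1 + j) % 2 = 0 := by omega
    simp only [out, h, h', if_true, if_false, Finset.mem_insert, Finset.mem_singleton,
      exists_eq_or_imp, exists_eq_left, left, right, Prod.mk.injEq]
    omega
  · have h' : (i + (j - 1)) % 2 = 0 := by omega
    simp only [out, h, h', if_true, if_false, Finset.mem_insert, Finset.mem_singleton,
      exists_eq_or_imp, exists_eq_left, left, right, Prod.mk.injEq]
    omega

theorem star_inn {v f : ℤ × ℤ} : (∃ e, tgt e = v ∧ (left e = f ∨ right e = f)) ↔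
    (f.1 = v.1 ∨ f.1 = v.1 + 1) ∧ (f.2 = v.2 ∨ f.2 = v.2 + 1) := by
  obtain ⟨a, b⟩ := f
  obtain ⟨i, j⟩ := v
  simp only [← mem_inn]
  by_cases h : (i + j) % 2 = 0
  · have h' : ¬ (i + (j - 1)) % 2 = 0 := by omega
    simp only [inn, h, h', if_true, if_false, Finset.mem_insert, Finset.mem_singleton,
      exists_eq_or_imp, exists_eq_left, left, right, Prod.mk.injEq]
    omega
  · have h' : (i - 1 + j) % 2 = 0 := by omega
    simp only [inn, h, h', if_true, if_false, Finset.mem_insert, Finset.mem_singleton,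
      exists_eq_or_imp, exists_eq_left, left, right, Prod.mk.injEq]
    omega

theorem sum_coboundary {G : Type} [AddCommGroup G] (K : ℤ × ℤ → G) (f : ℤ × ℤ) :
    ∑ e ∈ bdry f, (K (tgt e) - K (src e)) = 0 := by
  obtain ⟨a, b⟩ := f
  rw [sum_bdry]
  by_cases h : (a + b) % 2 = 0
  · have h₁ : (a - 1 + (b - 1)) % 2 = 0 := by omega
    have h₂ : ¬ (a - 1 + b) % 2 = 0 := by omega
    have h₃ : ¬ (a + (b - 1)) % 2 = 0 := by omega
    simp only [src, tgt, h₁, h₂, h₃, if_true, if_false, sub_add_cancel]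
    abel
  · have h₁ : ¬ (a - 1 + (b - 1)) % 2 = 0 := by omega
    have h₂ : (a - 1 + b) % 2 = 0 := by omega
    have h₃ : (a + (b - 1)) % 2 = 0 := by omega
    simp only [src, tgt, h₁, h₂, h₃, if_true, if_false, sub_add_cancel]
    abel

theorem exists_potential {G : Type} [AddCommGroup G] (φ : Edge → G)
    (hφ : ∀ f, ∑ e ∈ bdry f, φ e = 0) :
    ∃ K : ℤ × ℤ → G, ∀ e, K (tgt e) - K (src e) = φ e := by
  obtain ⟨K, hh, hv⟩ := exists_grid_potential
    (fun i j => if (i + j) % 2 = 0 then φ (i, j, true) else -φ (i, j, true))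
    (fun i j => if (i + j) % 2 = 0 then -φ (i, j, false) else φ (i, j, false)) (by
      intro i j
      have := hφ (i + 1, j + 1)
      rw [sum_bdry] at this
      simp only [add_sub_cancel_right] at this
      by_cases h : (i + j) % 2 = 0
      · have h₁ : ¬ (i + 1 + j) % 2 = 0 := by omega
        have h₂ : ¬ (i + (j + 1)) % 2 = 0 := by omega
        simp only [h, h₁, h₂, if_true, if_false]
        rw [← sub_eq_zero, ← this]
        abel
      · have h₁ : (i + 1 + j) % 2 = 0 := by omega
        have h₂ : (i + (j + 1)) % 2 = 0 := by omega
        simp only [h, h₁, h₂, if_true, if_false]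
        rw [← sub_eq_zero, ← neg_eq_zero, ← this]
        abel)
  refine ⟨fun v => K v.1 v.2, ?_⟩
  rintro ⟨i, j, _ | _⟩
  · have := hv i j
    by_cases h : (i + j) % 2 = 0 <;> simp only [src, tgt, h, if_true, if_false] at this ⊢
    · rw [← neg_sub, this, neg_neg]
    · exact this
  · have := hh i j
    by_cases h : (i + j) % 2 = 0 <;> simp only [src, tgt, h, if_true, if_false] at this ⊢
    · exact this
    · rw [← neg_sub, this, neg_neg]

theorem coboundary_eq_zero_iff {G : Type} (K : ℤ × ℤ → G) (i j : ℤ) :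
    (K (tgt (i, j, true)) = K (src (i, j, true)) ↔ K (i + 1, j) = K (i, j)) ∧
      (K (tgt (i, j, false)) = K (src (i, j, false)) ↔ K (i, j + 1) = K (i, j)) := by
  by_cases h : (i + j) % 2 = 0 <;> simp [src, tgt, h, eq_comm]

theorem const_on_face {G : Type} (K : ℤ × ℤ → G) (f : ℤ × ℤ)
    (h : ∀ e ∈ bdry f, K (tgt e) = K (src e)) : ∀ e ∈ bdry f, K (src e) = K f := by
  obtain ⟨a, b⟩ := f
  simp only [bdry, Finset.forall_mem_insert, Finset.mem_singleton, forall_eq,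
    coboundary_eq_zero_iff, sub_add_cancel] at h ⊢
  obtain ⟨h₁, h₂, h₃, h₄⟩ := h
  refine ⟨?_, ?_, ?_, ?_⟩ <;> simp only [src] <;> split_ifs <;>
    simp only [sub_add_cancel, h₁, h₂, h₃]

theorem const_off_finite {G : Type} (K : ℤ × ℤ → G) (R : Finset (ℤ × ℤ))
    (h : ∀ e, ¬ (left e ∈ R ∧ right e ∈ R) → K (tgt e) = K (src e)) :
    ∃ k, {v | K v ≠ k}.Finite := by
  obtain ⟨N, hN⟩ := (R.image fun f => max |f.1| |f.2|).exists_le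
  have hR : ∀ a b : ℤ, N < |a| ∨ N < |b| → (a, b) ∉ R := by
    intro a b hab hR
    have := max_le_iff.1 (hN _ (Finset.mem_image_of_mem _ hR))
    simp only at this
    omega
  -- The margin of one absorbs the shift between an edge and its left face.
  have key : ∀ e : Edge, (N + 1 < |e.1| ∨ N + 1 < |e.2.1|) → ¬ (left e ∈ R ∧ right e ∈ R) := by
    rintro ⟨i, j, k⟩ hij ⟨hl, -⟩
    simp only at hij
    refine hR (left (i, j, k)).1 (left (i, j, k)).2 ?_ hl
    simp only [lt_abs] at hij ⊢
    cases k <;> simp only [left] <;> split_ifs <;> omega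
  refine grid_const_off_box K (N + 1) fun i j hij => ⟨?_, ?_⟩
  · exact (coboundary_eq_zero_iff K i j).1.1 (h _ (key _ hij))
  · exact (coboundary_eq_zero_iff K i j).2.1 (h _ (key _ hij))

noncomputable def pos (s : ℤ × ℤ) : ℂ := ⟨s.1 + 1, s.2 + 1⟩

noncomputable def center (f : ℤ × ℤ) : ℂ := ⟨f.1 + 1 / 2, f.2 + 1 / 2⟩

theorem mem_filling {s : ℤ × ℤ} {d : Finset (ℤ × ℤ)} :
    (d ∈ quadriculated.filling s (decide ((s.1 + s.2) % 2 = 0)) ↔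
      ∃ e, src e = s ∧ d = {left e, right e}) ∧
    (d ∈ quadriculated.filling s (!decide ((s.1 + s.2) % 2 = 0)) ↔
      ∃ e, tgt e = s ∧ d = {left e, right e}) := by
  obtain ⟨i, j⟩ := s
  simp only [← mem_out, ← mem_inn]
  by_cases h : (i + j) % 2 = 0
  · simp only [h, decide_true, Bool.not_true, Finset.mem_insert, Finset.mem_singleton, out, inn,
      if_true, exists_eq_or_imp, exists_eq_left, tile_horizontal, tile_vertical, sub_add_cancel,
      and_self]
  · simp only [h, decide_false, Bool.not_false, Finset.mem_insert, Finset.mem_singleton, out, inn,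
      if_false, exists_eq_or_imp, exists_eq_left, tile_horizontal, tile_vertical, sub_add_cancel,
      and_self]

theorem isTile_iff {d : Finset (ℤ × ℤ)} :
    quadriculated.IsTile d ↔ ∃ e, d = {left e, right e} := by
  constructor
  · rintro ⟨i, j, h | h⟩
    · exact ⟨(i, j - 1, false), by rw [h, tile_vertical, sub_add_cancel]⟩
    · exact ⟨(i - 1, j, true), by rw [h, tile_horizontal, sub_add_cancel]⟩
  · rintro ⟨⟨i, j, _ | _⟩, h⟩
    · exact ⟨i, j + 1, Or.inl (by rw [h, tile_vertical])⟩
    · exact ⟨i + 1, j, Or.inr (by rw [h, tile_horizontal])⟩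

theorem edge_ext {e e' : Edge} (hl : left e = left e') (hr : right e = right e') : e = e' := by
  obtain ⟨i, j, _ | _⟩ := e <;> obtain ⟨i', j', _ | _⟩ := e' <;> simp only [left, right] at hl hr <;>
    split_ifs at hl hr <;> simp only [Prod.mk.injEq, and_true] at hl hr ⊢ <;> omega

theorem pos_mem_polygon {e : Edge} {f : ℤ × ℤ} (he : e ∈ bdry f) :
    pos (src e) ∈ quadriculated.polygon f ∧ pos (tgt e) ∈ quadriculated.polygon f := by
  obtain ⟨a, b⟩ := f
  simp only [bdry, Finset.mem_insert, Finset.mem_singleton] at he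
  rcases he with rfl | rfl | rfl | rfl <;> simp only [src, tgt] <;> split_ifs <;>
    simp [pos, Complex.mem_reProdIm]

theorem center_notMem_polygon {f f' : ℤ × ℤ} (h : f ≠ f') :
    center f ∉ quadriculated.polygon f' := by
  obtain ⟨a, b⟩ := f
  obtain ⟨a', b'⟩ := f'
  rintro ⟨⟨h₁, h₂⟩, h₃, h₄⟩
  simp only [center] at h₁ h₂ h₃ h₄
  have e₁ : (a' : ℝ) < a + 1 := by linarith
  have e₂ : (a : ℝ) < a' + 1 := by linarith
  have e₃ : (b' : ℝ) < b + 1 := by linarith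
  have e₄ : (b : ℝ) < b' + 1 := by linarith
  norm_cast at e₁ e₂ e₃ e₄
  exact h (Prod.ext (by simp only; omega) (by simp only; omega))

/-- Consecutive corners differ by a quarter turn about the centre: counterclockwise around black
faces, clockwise around white ones. -/
theorem rotation (f : ℤ × ℤ) : ∃ r : ℂ, r ≠ 0 ∧ r ≠ 1 ∧
    ∀ e ∈ bdry f, (pos (tgt e) - center f) / (pos (src e) - center f) = r := by
  obtain ⟨a, b⟩ := f
  have key : ∀ x y x' y' r : ℂ, x ≠ 0 → y = r * x → (x' = x) → (y' = y) → y' / x' = r := by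
    rintro x y _ _ r hx rfl rfl rfl
    rw [mul_div_cancel_right₀ _ hx]
  have h₁ : (⟨1 / 2, 1 / 2⟩ : ℂ) ≠ 0 := by simp [Complex.ext_iff]
  have h₂ : (⟨1 / 2, -1 / 2⟩ : ℂ) ≠ 0 := by simp [Complex.ext_iff]
  have h₃ : (⟨-1 / 2, 1 / 2⟩ : ℂ) ≠ 0 := by simp [Complex.ext_iff]
  have h₄ : (⟨-1 / 2, -1 / 2⟩ : ℂ) ≠ 0 := by simp [Complex.ext_iff]
  by_cases h : (a + b) % 2 = 0
  · have e₁ : (a - 1 + (b - 1)) % 2 = 0 := by omega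
    have e₂ : ¬ (a - 1 + b) % 2 = 0 := by omega
    have e₃ : ¬ (a + (b - 1)) % 2 = 0 := by omega
    refine ⟨Complex.I, by simp, by simp [Complex.ext_iff], ?_⟩
    simp only [bdry, Finset.forall_mem_insert, Finset.mem_singleton, forall_eq, src, tgt, e₁, e₂, e₃,
      if_true, if_false, sub_add_cancel]
    refine ⟨key _ ⟨1 / 2, -1 / 2⟩ _ _ _ h₄ ?_ ?_ ?_, key _ ⟨-1 / 2, 1 / 2⟩ _ _ _ h₁ ?_ ?_ ?_,
      key _ ⟨-1 / 2, -1 / 2⟩ _ _ _ h₃ ?_ ?_ ?_, key _ ⟨1 / 2, 1 / 2⟩ _ _ _ h₂ ?_ ?_ ?_⟩ <;>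
      apply Complex.ext <;> simp [pos, center] <;> ring
  · have e₁ : ¬ (a - 1 + (b - 1)) % 2 = 0 := by omega
    have e₂ : (a - 1 + b) % 2 = 0 := by omega
    have e₃ : (a + (b - 1)) % 2 = 0 := by omega
    refine ⟨-Complex.I, by simp, by simp [Complex.ext_iff], ?_⟩
    simp only [bdry, Finset.forall_mem_insert, Finset.mem_singleton, forall_eq, src, tgt, e₁, e₂, e₃,
      if_true, if_false, sub_add_cancel]
    refine ⟨key _ ⟨-1 / 2, -1 / 2⟩ _ _ _ h₂ ?_ ?_ ?_, key _ ⟨1 / 2, 1 / 2⟩ _ _ _ h₃ ?_ ?_ ?_,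
      key _ ⟨-1 / 2, 1 / 2⟩ _ _ _ h₄ ?_ ?_ ?_, key _ ⟨1 / 2, -1 / 2⟩ _ _ _ h₁ ?_ ?_ ?_⟩ <;>
      apply Complex.ext <;> simp [pos, center] <;> ring

end Quad

/-- The planar model of the quadriculated plane. -/
noncomputable def quadModel : PlanarModel quadriculated where
  E := Quad.Edge
  src := Quad.src
  tgt := Quad.tgt
  left := Quad.left
  right := Quad.right
  black f := (f.1 + f.2) % 2 = 0
  deg := 4
  bdry := Quad.bdry
  out := Quad.out
  up s := decide ((s.1 + s.2) % 2 = 0)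
  pos := Quad.pos
  center := Quad.center
  infinite := inferInstanceAs (Infinite (ℤ × ℤ))
  black_left := by
    rintro ⟨i, j, _ | _⟩ <;> simp only [Quad.left] <;> split_ifs <;> simp only <;> omega
  not_black_right := by
    rintro ⟨i, j, _ | _⟩ <;> simp only [Quad.right] <;> split_ifs <;> simp only <;> omega
  mem_bdry := Quad.mem_bdry
  card_bdry f := by
    rw [Finset.card_eq_sum_ones]
    exact_mod_cast Quad.sum_bdry (fun _ => (1 : ℤ)) f.1 f.2
  deg_pos := by norm_num
  mem_out := Quad.mem_out
  out_nonempty v := by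
    simp only [Quad.out]
    split_ifs <;> exact Finset.insert_nonempty _ _
  src_ne_tgt := by
    rintro ⟨i, j, _ | _⟩ <;> simp only [Quad.src, Quad.tgt] <;> split_ifs <;> simp
  edge_ext := Quad.edge_ext
  isTile_iff := Quad.isTile_iff
  mem_filling_up := Quad.mem_filling.1
  mem_filling_not_up := Quad.mem_filling.2
  star := Quad.star_out.trans Quad.star_inn.symm
  sum_coboundary := Quad.sum_coboundary
  exists_potential := Quad.exists_potential
  const_of_coboundary_eq_zero K h := grid_const K
    (fun i j => (Quad.coboundary_eq_zero_iff K i j).1.1 (h _))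
    (fun i j => (Quad.coboundary_eq_zero_iff K i j).2.1 (h _))
  const_on_face K f h := ⟨_, Quad.const_on_face K f h⟩
  const_off_finite := Quad.const_off_finite
  convex_polygon f := ((convex_Icc (f.1 : ℝ) (f.1 + 1)).linear_preimage Complex.reLm).inter
    ((convex_Icc (f.2 : ℝ) (f.2 + 1)).linear_preimage Complex.imLm)
  isClosed_polygon _ := isClosed_Icc.reProdIm isClosed_Icc
  src_mem_polygon he := (Quad.pos_mem_polygon he).1
  tgt_mem_polygon he := (Quad.pos_mem_polygon he).2
  center_notMem_polygon := Quad.center_notMem_polygon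
  rotation := Quad.rotation

/-! ### The planar model of triangles and lozenges -/

namespace Tri

/-- The edges `(i, j, k)` for `k = 0, 1, 2` are the sides of the black triangle `(i, j, true)`,
counterclockwise. Every edge has exactly one black side, so each is listed once. -/
abbrev Edge : Type := ℤ × ℤ × Fin 3

def src : Edge → ℤ × ℤ
  | (i, j, 0) => (i, j)
  | (i, j, 1) => (i + 1, j)
  | (i, j, 2) => (i, j + 1)

def tgt : Edge → ℤ × ℤ
  | (i, j, 0) => (i + 1, j)
  | (i, j, 1) => (i, j + 1)
  | (i, j, 2) => (i, j)

def left (e : Edge) : ℤ × ℤ × Bool := (e.1, e.2.1, true)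

def right : Edge → ℤ × ℤ × Bool
  | (i, j, 0) => (i, j - 1, false)
  | (i, j, 1) => (i, j, false)
  | (i, j, 2) => (i - 1, j, false)

def bdry : ℤ × ℤ × Bool → Finset Edge
  | (i, j, true) => {(i, j, 0), (i, j, 1), (i, j, 2)}
  | (i, j, false) => {(i, j + 1, 0), (i, j, 1), (i + 1, j, 2)}

def out (s : ℤ × ℤ) : Finset Edge := {(s.1, s.2, 0), (s.1 - 1, s.2, 1), (s.1, s.2 - 1, 2)}

def inn (s : ℤ × ℤ) : Finset Edge := {(s.1 - 1, s.2, 0), (s.1, s.2 - 1, 1), (s.1, s.2, 2)}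

theorem mem_bdry {e : Edge} {f : ℤ × ℤ × Bool} : e ∈ bdry f ↔ left e = f ∨ right e = f := by
  obtain ⟨i, j, k⟩ := e
  obtain ⟨a, b, _ | _⟩ := f <;> fin_cases k <;> simp [bdry, left, right] <;> omega

theorem mem_out {e : Edge} {s : ℤ × ℤ} : e ∈ out s ↔ src e = s := by
  obtain ⟨i, j, k⟩ := e
  obtain ⟨a, b⟩ := s
  fin_cases k <;> simp [out, src] <;> omega

theorem mem_inn {e : Edge} {s : ℤ × ℤ} : e ∈ inn s ↔ tgt e = s := by
  obtain ⟨i, j, k⟩ := e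
  obtain ⟨a, b⟩ := s
  fin_cases k <;> simp [inn, tgt] <;> omega

theorem sum_bdry_true {G : Type} [AddCommGroup G] (g : Edge → G) (a b : ℤ) :
    ∑ e ∈ bdry (a, b, true), g e = g (a, b, 0) + (g (a, b, 1) + g (a, b, 2)) := by
  rw [bdry, Finset.sum_insert, Finset.sum_insert, Finset.sum_singleton] <;> simp

theorem sum_bdry_false {G : Type} [AddCommGroup G] (g : Edge → G) (a b : ℤ) :
    ∑ e ∈ bdry (a, b, false), g e = g (a, b + 1, 0) + (g (a, b, 1) + g (a + 1, b, 2)) := by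
  rw [bdry, Finset.sum_insert, Finset.sum_insert, Finset.sum_singleton] <;> simp

theorem mem_filling {s : ℤ × ℤ} {d : Finset (ℤ × ℤ × Bool)} :
    (d ∈ triangulated.filling s true ↔ ∃ e, src e = s ∧ d = {left e, right e}) ∧
    (d ∈ triangulated.filling s false ↔ ∃ e, tgt e = s ∧ d = {left e, right e}) := by
  obtain ⟨i, j⟩ := s
  simp only [← mem_out, ← mem_inn]
  simp only [Finset.mem_insert, Finset.mem_singleton, out, inn, exists_eq_or_imp, exists_eq_left,
    left, right]
  tauto

theorem isTile_iff {d : Finset (ℤ × ℤ × Bool)} :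
    triangulated.IsTile d ↔ ∃ e, d = {left e, right e} := by
  constructor
  · rintro ⟨i, j, h | h | h⟩
    · exact ⟨(i, j, 1), h⟩
    · exact ⟨(i, j, 2), h⟩
    · exact ⟨(i, j, 0), h⟩
  · rintro ⟨⟨i, j, k⟩, h⟩
    refine ⟨i, j, ?_⟩
    fin_cases k
    · exact Or.inr (Or.inr h)
    · exact Or.inl h
    · exact Or.inr (Or.inl h)

theorem star {v : ℤ × ℤ} {f : ℤ × ℤ × Bool} :
    (∃ e, src e = v ∧ (left e = f ∨ right e = f)) ↔
      ∃ e, tgt e = v ∧ (left e = f ∨ right e = f) := by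
  obtain ⟨a, b, k⟩ := f
  obtain ⟨i, j⟩ := v
  simp only [← mem_out, ← mem_inn]
  simp only [Finset.mem_insert, Finset.mem_singleton, out, inn, exists_eq_or_imp, exists_eq_left,
    left, right, Prod.mk.injEq]
  tauto

theorem sum_coboundary {G : Type} [AddCommGroup G] (K : ℤ × ℤ → G) (f : ℤ × ℤ × Bool) :
    ∑ e ∈ bdry f, (K (tgt e) - K (src e)) = 0 := by
  obtain ⟨a, b, _ | _⟩ := f
  · rw [sum_bdry_false]
    simp only [src, tgt]
    abel
  · rw [sum_bdry_true]
    simp only [src, tgt]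
    abel

/-- The edges of types 0 and 2 form a square grid. Its unit cells consist of two triangles sharing
an edge of type 1, whose contribution cancels in the difference of the two face sums; the value on
that edge is then forced by the black triangle. -/
theorem exists_potential {G : Type} [AddCommGroup G] (φ : Edge → G)
    (hφ : ∀ f, ∑ e ∈ bdry f, φ e = 0) :
    ∃ K : ℤ × ℤ → G, ∀ e, K (tgt e) - K (src e) = φ e := by
  obtain ⟨K, hh, hv⟩ := exists_grid_potential
    (fun i j => φ (i, j, 0)) (fun i j => -φ (i, j, 2)) (by
      intro i j
      have h₁ := hφ (i, j, true)
      have h₂ := hφ (i, j, false)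
      rw [sum_bdry_true] at h₁
      rw [sum_bdry_false] at h₂
      rw [← sub_eq_zero, ← sub_eq_zero.2 (h₁.trans h₂.symm)]
      abel)
  refine ⟨fun v => K v.1 v.2, ?_⟩
  rintro ⟨i, j, k⟩
  have h₁ := hφ (i, j, true)
  rw [sum_bdry_true] at h₁
  have h₂ := hv i j
  fin_cases k
  · exact hh i j
  · change K i (j + 1) - K (i + 1) j = φ (i, j, 1)
    rw [← sub_sub_sub_cancel_right _ _ (K i j), hh, hv, ← sub_eq_zero, ← neg_eq_zero, ← h₁]
    abel
  · change K i j - K i (j + 1) = φ (i, j, 2)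
    rw [← neg_sub, h₂, neg_neg]

theorem const_on_face {G : Type} (K : ℤ × ℤ → G) (f : ℤ × ℤ × Bool)
    (h : ∀ e ∈ bdry f, K (tgt e) = K (src e)) : ∃ k, ∀ e ∈ bdry f, K (src e) = k := by
  obtain ⟨a, b, _ | _⟩ := f <;>
    simp only [bdry, Finset.forall_mem_insert, Finset.mem_singleton, forall_eq, src, tgt] at h ⊢ <;>
    obtain ⟨h₁, h₂, h₃⟩ := h
  · exact ⟨_, rfl, h₂.symm, h₁⟩
  · exact ⟨_, rfl, h₁, h₃.symm⟩

theorem const_off_finite {G : Type} (K : ℤ × ℤ → G) (R : Finset (ℤ × ℤ × Bool))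
    (h : ∀ e, ¬ (left e ∈ R ∧ right e ∈ R) → K (tgt e) = K (src e)) :
    ∃ k, {v | K v ≠ k}.Finite := by
  obtain ⟨N, hN⟩ := (R.image fun f => max |f.1| |f.2.1|).exists_le
  have key : ∀ e : Edge, (N < |e.1| ∨ N < |e.2.1|) → ¬ (left e ∈ R ∧ right e ∈ R) := by
    rintro ⟨i, j, k⟩ hij ⟨hl, -⟩
    have := max_le_iff.1 (hN _ (Finset.mem_image_of_mem _ hl))
    simp only [left] at this hij
    omega
  refine grid_const_off_box K N fun i j hij => ⟨?_, ?_⟩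
  · exact h (i, j, 0) (key _ hij)
  · exact (h (i, j, 2) (key _ hij)).symm

noncomputable def pos (s : ℤ × ℤ) : ℂ := oblique (s.1, s.2)

noncomputable def center : ℤ × ℤ × Bool → ℂ
  | (i, j, true) => oblique (i + 1 / 3, j + 1 / 3)
  | (i, j, false) => oblique (i + 2 / 3, j + 2 / 3)

noncomputable def coords (z : ℂ) : ℝ × ℝ := (z.re - z.im / √3, 2 * z.im / √3)

theorem coords_oblique (p : ℝ × ℝ) : coords (oblique p) = p := by
  have : √3 ≠ 0 := by positivity
  ext
  · simp [coords, oblique]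
    field_simp
    ring
  · simp [coords, oblique]
    field_simp

theorem oblique_coords (z : ℂ) : oblique (coords z) = z := by
  have : √3 ≠ 0 := by positivity
  apply Complex.ext <;> simp [coords, oblique] <;> field_simp
  ring

theorem oblique_image (S : Set (ℝ × ℝ)) : oblique '' S = coords ⁻¹' S :=
  congrFun (Set.image_eq_preimage_of_inverse coords_oblique oblique_coords) S

theorem isLinearMap_oblique : IsLinearMap ℝ oblique where
  map_add p q := by
    simp only [oblique, Prod.fst_add, Prod.snd_add]
    push_cast
    ring
  map_smul c p := by
    simp only [oblique, Prod.smul_fst, Prod.smul_snd, smul_eq_mul, Complex.real_smul]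
    push_cast
    ring

theorem convex_polygon (f : ℤ × ℤ × Bool) : Convex ℝ (triangulated.polygon f) := by
  obtain ⟨i, j, _ | _⟩ := f <;> refine Convex.is_linear_image ?_ isLinearMap_oblique <;>
    refine .inter ?_ (.inter ?_ ?_)
  · exact convex_halfSpace_le (LinearMap.fst ℝ ℝ ℝ).isLinear _
  · exact convex_halfSpace_le (LinearMap.snd ℝ ℝ ℝ).isLinear _
  · exact convex_halfSpace_ge (LinearMap.fst ℝ ℝ ℝ + LinearMap.snd ℝ ℝ ℝ).isLinear _
  · exact convex_halfSpace_ge (LinearMap.fst ℝ ℝ ℝ).isLinear _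
  · exact convex_halfSpace_ge (LinearMap.snd ℝ ℝ ℝ).isLinear _
  · exact convex_halfSpace_le (LinearMap.fst ℝ ℝ ℝ + LinearMap.snd ℝ ℝ ℝ).isLinear _

theorem isClosed_polygon (f : ℤ × ℤ × Bool) : IsClosed (triangulated.polygon f) := by
  have hc : Continuous coords := by
    unfold coords
    fun_prop
  obtain ⟨i, j, _ | _⟩ := f <;>
    change IsClosed (oblique '' _) <;> rw [oblique_image] <;>
    refine IsClosed.preimage hc (.inter ?_ (.inter ?_ ?_))
  · exact isClosed_le continuous_fst continuous_const
  · exact isClosed_le continuous_snd continuous_const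
  · exact isClosed_le continuous_const (continuous_fst.add continuous_snd)
  · exact isClosed_le continuous_const continuous_fst
  · exact isClosed_le continuous_const continuous_snd
  · exact isClosed_le (continuous_fst.add continuous_snd) continuous_const

theorem pos_mem_polygon {e : Edge} {f : ℤ × ℤ × Bool} (he : e ∈ bdry f) :
    pos (src e) ∈ triangulated.polygon f ∧ pos (tgt e) ∈ triangulated.polygon f := by
  obtain ⟨a, b, _ | _⟩ := f <;> simp only [bdry, Finset.mem_insert, Finset.mem_singleton] at he <;>
    rcases he with rfl | rfl | rfl <;> simp only [src, tgt] <;>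
    constructor <;> refine Set.mem_image_of_mem _ ?_ <;> simp <;> linarith

theorem center_notMem_polygon {f f' : ℤ × ℤ × Bool} (h : f ≠ f') :
    center f ∉ triangulated.polygon f' := by
  obtain ⟨a, b, _ | _⟩ := f <;> obtain ⟨a', b', _ | _⟩ := f' <;> intro hm <;>
    change _ ∈ oblique '' _ at hm <;> rw [oblique_image] at hm <;>
    simp only [center, Set.mem_preimage, coords_oblique] at hm <;> obtain ⟨h₁, h₂, h₃⟩ := hm <;>
    simp only at h₁ h₂ h₃
  · have e₁ : (a : ℝ) < a' + 1 := by linarith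
    have e₂ : (b : ℝ) < b' + 1 := by linarith
    have e₃ : (a' : ℝ) + b' < a + b + 1 := by linarith
    norm_cast at e₁ e₂ e₃
    exact h (Prod.ext (by simp only; omega) (Prod.ext (by simp only; omega) rfl))
  · have e₁ : (a' : ℝ) < a + 1 := by linarith
    have e₂ : (b' : ℝ) < b + 1 := by linarith
    have e₃ : (a : ℝ) + b < a' + b' := by linarith
    norm_cast at e₁ e₂ e₃
    omega
  · have e₁ : (a : ℝ) < a' + 1 := by linarith
    have e₂ : (b : ℝ) < b' + 1 := by linarith
    have e₃ : (a' : ℝ) + b' < a + b := by linarith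
    norm_cast at e₁ e₂ e₃
    omega
  · have e₁ : (a' : ℝ) < a + 1 := by linarith
    have e₂ : (b' : ℝ) < b + 1 := by linarith
    have e₃ : (a : ℝ) + b < a' + b' + 1 := by linarith
    norm_cast at e₁ e₂ e₃
    exact h (Prod.ext (by simp only; omega) (Prod.ext (by simp only; omega) rfl))

theorem oblique_sub_ne_zero {p q : ℝ × ℝ} (h : p.1 ≠ q.1) : oblique p - oblique q ≠ 0 := by
  intro h0
  have := congrArg coords (sub_eq_zero.1 h0)
  rw [coords_oblique, coords_oblique] at this
  exact h (congrArg Prod.fst this)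

theorem rotation (f : ℤ × ℤ × Bool) : ∃ r : ℂ, r ≠ 0 ∧ r ≠ 1 ∧
    ∀ e ∈ bdry f, (pos (tgt e) - center f) / (pos (src e) - center f) = r := by
  set ω : ℂ := ⟨1 / 2, √3 / 2⟩ with hω
  have h3 : √3 ≠ 0 := by positivity
  -- The rotation ratios are `ω - 1` and `-ω`, the two primitive cube roots of unity; all identities
  -- reduce to this relation.
  have hω2 : ω ^ 2 = ω - 1 := by
    have hs : √3 * √3 = 3 := Real.mul_self_sqrt (by norm_num)
    apply Complex.ext <;> simp [hω, sq]
    · linear_combination -(1 / 4 : ℝ) * hs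
    · ring
  obtain ⟨a, b, _ | _⟩ := f
  · refine ⟨-ω, by simp [hω, Complex.ext_iff], by simp [hω, Complex.ext_iff, h3], ?_⟩
    simp only [bdry, Finset.forall_mem_insert, Finset.mem_singleton, forall_eq, src, tgt, pos,
      center]
    refine ⟨?_, ?_, ?_⟩ <;> rw [div_eq_iff (oblique_sub_ne_zero ?_)]
    all_goals try (simp only [oblique, ← hω]; push_cast)
    · linear_combination (1 / 3 : ℂ) * hω2
    · norm_num
    · linear_combination (-2 / 3 : ℂ) * hω2
    · norm_num
    · linear_combination (1 / 3 : ℂ) * hω2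
    · norm_num
  · refine ⟨ω - 1, by simp [hω, Complex.ext_iff, h3], by simp [hω, Complex.ext_iff, h3], ?_⟩
    simp only [bdry, Finset.forall_mem_insert, Finset.mem_singleton, forall_eq, src, tgt, pos,
      center]
    refine ⟨?_, ?_, ?_⟩ <;> rw [div_eq_iff (oblique_sub_ne_zero ?_)]
    all_goals try (simp only [oblique, ← hω]; push_cast)
    · linear_combination (1 / 3 : ℂ) * hω2
    · norm_num
    · linear_combination (1 / 3 : ℂ) * hω2
    · norm_num
    · linear_combination (-2 / 3 : ℂ) * hω2
    · norm_num

end Tri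

/-- The planar model of the triangulated plane. -/
noncomputable def triModel : PlanarModel triangulated where
  E := Tri.Edge
  src := Tri.src
  tgt := Tri.tgt
  left := Tri.left
  right := Tri.right
  black f := f.2.2 = true
  deg := 3
  bdry := Tri.bdry
  out := Tri.out
  up _ := true
  pos := Tri.pos
  center := Tri.center
  infinite := inferInstanceAs (Infinite (ℤ × ℤ))
  black_left _ := rfl
  not_black_right := by
    rintro ⟨i, j, k⟩
    fin_cases k <;> simp [Tri.right]
  mem_bdry := Tri.mem_bdry
  card_bdry := by
    rintro ⟨a, b, _ | _⟩
    · rw [Finset.card_eq_sum_ones]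
      exact_mod_cast Tri.sum_bdry_false (fun _ => (1 : ℤ)) a b
    · rw [Finset.card_eq_sum_ones]
      exact_mod_cast Tri.sum_bdry_true (fun _ => (1 : ℤ)) a b
  deg_pos := by norm_num
  mem_out := Tri.mem_out
  out_nonempty _ := Finset.insert_nonempty _ _
  src_ne_tgt := by
    rintro ⟨i, j, k⟩
    fin_cases k <;> simp [Tri.src, Tri.tgt]
  edge_ext := by
    rintro ⟨i, j, k⟩ ⟨i', j', k'⟩
    fin_cases k <;> fin_cases k' <;> simp [Tri.left, Tri.right] <;> omega
  isTile_iff := Tri.isTile_iff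
  mem_filling_up := Tri.mem_filling.1
  mem_filling_not_up := Tri.mem_filling.2
  star := Tri.star
  sum_coboundary := Tri.sum_coboundary
  exists_potential := Tri.exists_potential
  const_of_coboundary_eq_zero K h := grid_const K
    (fun i j => h (i, j, 0)) (fun i j => (h (i, j, 2)).symm)
  const_on_face := Tri.const_on_face
  const_off_finite := Tri.const_off_finite
  convex_polygon := Tri.convex_polygon
  isClosed_polygon := Tri.isClosed_polygon
  src_mem_polygon he := (Tri.pos_mem_polygon he).1
  tgt_mem_polygon he := (Tri.pos_mem_polygon he).2
  center_notMem_polygon := Tri.center_notMem_polygon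
  rotation := Tri.rotation

/-! ### Height functions of tilings -/

namespace PlanarModel

variable {L : TileSystem} (M : PlanarModel L) {R : Finset L.Face}

/-- The tile formed by the two faces along an edge. -/
def tile (e : M.E) : Finset L.Face := {M.left e, M.right e}

/-- A vertex is interior to `R` if all faces around it belong to `R`. -/
def Interior (R : Finset L.Face) (v : L.Site) : Prop :=
  ∀ e, M.src e = v ∨ M.tgt e = v → M.left e ∈ R ∧ M.right e ∈ R

/-- The indicator function, on the edges, of the tiles of a tiling. -/
def ind (t : Tiling L R) (e : M.E) : ℤ := if M.tile e ∈ t.tiles then 1 else 0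

variable {M}

theorem mem_tile {e : M.E} {f : L.Face} : f ∈ M.tile e ↔ M.left e = f ∨ M.right e = f := by
  simp [tile, eq_comm]

theorem left_mem_tile (e : M.E) : M.left e ∈ M.tile e := mem_tile.2 (Or.inl rfl)

theorem right_mem_tile (e : M.E) : M.right e ∈ M.tile e := mem_tile.2 (Or.inr rfl)

theorem left_ne_right (e e' : M.E) : M.left e ≠ M.right e' :=
  fun h => M.not_black_right e' (h ▸ M.black_left e)

theorem tile_injective : Function.Injective M.tile := by
  intro e e' h
  refine M.edge_ext ?_ ?_
  · rcases mem_tile.1 (h ▸ left_mem_tile e) with h' | h'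
    · exact h'.symm
    · exact absurd h'.symm (left_ne_right _ _)
  · rcases mem_tile.1 (h ▸ right_mem_tile e) with h' | h'
    · exact absurd h' (left_ne_right _ _)
    · exact h'.symm

theorem exists_tile_eq (t : Tiling L R) {d : Finset L.Face} (hd : d ∈ t.tiles) :
    ∃ e, d = M.tile e := M.isTile_iff.1 (t.isTile d hd)

theorem eq_of_common_face (t : Tiling L R) {e e' : M.E} (he : M.tile e ∈ t.tiles)
    (he' : M.tile e' ∈ t.tiles) {f : L.Face} (hf : f ∈ M.tile e) (hf' : f ∈ M.tile e') : e = e' :=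
  tile_injective ((t.cover f (t.subset _ he hf)).unique ⟨he, hf⟩ ⟨he', hf'⟩)

theorem mem_of_tile_mem (t : Tiling L R) {e : M.E} (he : M.tile e ∈ t.tiles) :
    M.left e ∈ R ∧ M.right e ∈ R :=
  ⟨t.subset _ he (left_mem_tile e), t.subset _ he (right_mem_tile e)⟩

theorem ind_eq_one_iff {t : Tiling L R} {e : M.E} : M.ind t e = 1 ↔ M.tile e ∈ t.tiles := by
  simp [ind]

theorem ind_eq_zero_iff {t : Tiling L R} {e : M.E} : M.ind t e = 0 ↔ M.tile e ∉ t.tiles := by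
  simp [ind]

theorem ind_eq_zero_or_one (t : Tiling L R) (e : M.E) : M.ind t e = 0 ∨ M.ind t e = 1 := by
  unfold ind
  split_ifs <;> simp

theorem ind_eq_zero_of_not_mem (t : Tiling L R) {e : M.E}
    (he : ¬ (M.left e ∈ R ∧ M.right e ∈ R)) : M.ind t e = 0 :=
  ind_eq_zero_iff.2 fun h => he (mem_of_tile_mem t h)

theorem sum_ind (t : Tiling L R) (f : L.Face) :
    ∑ e ∈ M.bdry f, M.ind t e = if f ∈ R then 1 else 0 := by
  split_ifs with hf
  · obtain ⟨d, ⟨hd, hfd⟩, -⟩ := t.cover f hf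
    obtain ⟨e, rfl⟩ := exists_tile_eq (M := M) t hd
    rw [Finset.sum_eq_single e, ind_eq_one_iff.2 hd]
    · intro e' he' hne
      exact ind_eq_zero_iff.2 fun h =>
        hne (eq_of_common_face t h hd (mem_tile.2 (M.mem_bdry.1 he')) hfd)
    · exact fun h => absurd (M.mem_bdry.2 (mem_tile.1 hfd)) h
  · refine Finset.sum_eq_zero fun e he => ind_eq_zero_of_not_mem t fun h => hf ?_
    rcases M.mem_bdry.1 he with rfl | rfl
    exacts [h.1, h.2]

theorem ext_ind {t t' : Tiling L R} (h : ∀ e, M.ind t e = M.ind t' e) : t = t' := by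
  have aux : ∀ {t t' : Tiling L R}, (∀ e, M.ind t e = M.ind t' e) → t.tiles ⊆ t'.tiles := by
    intro t t' h d hd
    obtain ⟨e, rfl⟩ := exists_tile_eq (M := M) t hd
    exact ind_eq_one_iff.1 (h e ▸ ind_eq_one_iff.2 hd)
  exact Tiling.ext ((aux h).antisymm (aux fun e => (h e).symm))

theorem finite_interior (M : PlanarModel L) (R : Finset L.Face) : {v | M.Interior R v}.Finite := by
  classical
  refine ((R.biUnion M.bdry).image M.src).finite_toSet.subset fun v hv => ?_
  obtain ⟨e, he⟩ := M.out_nonempty v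
  rw [M.mem_out] at he
  exact Finset.mem_coe.2 (Finset.mem_image.2 ⟨e, Finset.mem_biUnion.2
    ⟨M.left e, (hv e (Or.inl he)).1, M.mem_bdry.2 (Or.inl rfl)⟩, he⟩)

theorem exists_not_interior (M : PlanarModel L) (R : Finset L.Face) : ∃ v, ¬ M.Interior R v := by
  have := M.infinite
  by_contra! h
  exact Set.infinite_univ ((M.finite_interior R).subset fun v _ => h v)

theorem not_interior {e : M.E} (he : ¬ (M.left e ∈ R ∧ M.right e ∈ R)) :
    ¬ M.Interior R (M.src e) ∧ ¬ M.Interior R (M.tgt e) :=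
  ⟨fun h => he (h e (Or.inl rfl)), fun h => he (h e (Or.inr rfl))⟩

/-- A function which is locally constant off a region without holes takes only one value
at the vertices which are not interior to the region. -/
theorem NoHoles.const_of_locally_const (hR : M.NoHoles R) (K : L.Site → ℤ)
    (hK : ∀ e, ¬ (M.left e ∈ R ∧ M.right e ∈ R) → K (M.tgt e) = K (M.src e)) :
    ∃ k, ∀ v, ¬ M.Interior R v → K v = k := by
  classical
  obtain ⟨k, hk⟩ := M.const_off_finite K R hK
  refine ⟨k, fun v hv => ?_⟩
  by_contra hvk
  have hface : ∀ f ∉ R, ∀ e ∈ M.bdry f, ∀ e' ∈ M.bdry f, K (M.src e) = K (M.src e') := by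
    intro f hf e he e' he'
    obtain ⟨c, hc⟩ := M.const_on_face K f fun e he => hK e fun h => hf <| by
      rcases M.mem_bdry.1 he with rfl | rfl
      exacts [h.1, h.2]
    rw [hc e he, hc e' he']
  have hfin : {f | f ∉ R ∧ ∃ e ∈ M.bdry f, K (M.src e) ≠ k}.Finite := by
    refine (hk.biUnion fun v _ => ((M.out v).image M.left ∪
      (M.out v).image M.right).finite_toSet).subset ?_
    rintro f ⟨-, e, he, hek⟩
    refine Set.mem_biUnion (x := M.src e) hek ?_
    rw [Finset.mem_coe, Finset.mem_union, Finset.mem_image, Finset.mem_image]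
    rcases M.mem_bdry.1 he with h | h
    · exact Or.inl ⟨e, M.mem_out.2 rfl, h⟩
    · exact Or.inr ⟨e, M.mem_out.2 rfl, h⟩
  -- The faces off `R` at which the value differs from the value at infinity. An edge between two
  -- faces off `R` has both of them in this set or neither.
  set H := hfin.toFinset with hH
  have memH : ∀ {f}, f ∈ H ↔ f ∉ R ∧ ∃ e ∈ M.bdry f, K (M.src e) ≠ k := by simp [hH]
  have memH' : ∀ {f e}, f ∉ R → e ∈ M.bdry f → (f ∈ H ↔ K (M.src e) ≠ k) := by
    intro f e hf he
    rw [memH]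
    exact ⟨fun ⟨_, e', he', h⟩ => hface f hf e he e' he' ▸ h, fun h => ⟨hf, e, he, h⟩⟩
  obtain ⟨f₀, hf₀⟩ : ∃ f₀, f₀ ∈ H := by
    unfold Interior at hv
    push Not at hv
    obtain ⟨e, hev, he⟩ := hv
    have hne : K (M.src e) ≠ k := by
      rcases hev with h | h
      · rwa [h]
      · rwa [← hK e (fun h => he h.1 h.2), h]
    by_cases hl : M.left e ∈ R
    · exact ⟨M.right e, (memH' (he hl) (M.mem_bdry.2 (Or.inr rfl))).2 hne⟩
    · exact ⟨M.left e, (memH' hl (M.mem_bdry.2 (Or.inl rfl))).2 hne⟩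
  obtain ⟨w, hw, hcurl⟩ := hR f₀ (memH.1 hf₀).1
  -- With these signs an edge contributes `w e` from its left face and `-w e` from its right one. So
  -- the signed sum over `H` vanishes: contributions cancel off `R`, and `w` is zero at `R`. But the
  -- winding at `f₀` makes it nonzero.
  set sgn : L.Face → ℂ := fun f => if M.black f then 1 else -1 with hsgn
  have h₁ : ∑ f ∈ H, sgn f * ∑ e ∈ M.bdry f, w e = sgn f₀ := by
    rw [Finset.sum_eq_single f₀]
    · rw [hcurl, if_pos rfl, mul_one]
    · intro f _ hne
      rw [hcurl, if_neg hne, mul_zero]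
    · exact fun h => absurd hf₀ h
  have h₂ : ∑ f ∈ H, sgn f * ∑ e ∈ M.bdry f, w e = 0 := by
    have : ∀ f ∈ H, sgn f * ∑ e ∈ M.bdry f, w e = ∑ e ∈ H.biUnion M.bdry,
        ((if M.left e = f then w e else 0) - (if M.right e = f then w e else 0)) := by
      intro f hf
      rw [Finset.mul_sum]
      refine Finset.sum_subset_zero_on_sdiff (Finset.subset_biUnion_of_mem M.bdry hf)
        (fun e he => ?_) (fun e he => ?_)
      · have := (Finset.mem_sdiff.1 he).2
        rw [M.mem_bdry, not_or] at this
        rw [if_neg this.1, if_neg this.2, sub_zero]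
      · rcases M.mem_bdry.1 he with rfl | rfl
        · rw [if_pos rfl, if_neg (left_ne_right _ _).symm]
          simp [hsgn, M.black_left]
        · rw [if_pos rfl, if_neg (left_ne_right _ _)]
          simp [hsgn, M.not_black_right]
    rw [Finset.sum_congr rfl this, Finset.sum_comm]
    refine Finset.sum_eq_zero fun e _ => ?_
    rw [Finset.sum_sub_distrib, Finset.sum_ite_eq, Finset.sum_ite_eq]
    by_cases he : M.left e ∈ R ∨ M.right e ∈ R
    · simp [hw e he]
    · rw [not_or] at he
      have : M.left e ∈ H ↔ M.right e ∈ H := by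
        rw [memH' he.1 (M.mem_bdry.2 (Or.inl rfl)), memH' he.2 (M.mem_bdry.2 (Or.inr rfl))]
      simp [this]
  have : sgn f₀ ≠ 0 := by
    simp only [hsgn]
    split_ifs <;> simp
  exact this (h₁.symm.trans h₂)

/-- The two indicators have the same sum around every face, so their difference has a potential. Off
`R` both vanish, so the potential is locally constant there, and without holes a single constant
normalises it. -/
theorem NoHoles.exists_height (hR : M.NoHoles R) (t₀ t : Tiling L R) :
    ∃ h : L.Site → ℤ, (∀ v, ¬ M.Interior R v → h v = 0) ∧
      ∀ e, h (M.tgt e) - h (M.src e) = M.ind t e - M.ind t₀ e := by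
  obtain ⟨K, hK⟩ := M.exists_potential (fun e => M.ind t e - M.ind t₀ e) fun f => by
    rw [Finset.sum_sub_distrib, sum_ind, sum_ind, sub_self]
  obtain ⟨k, hk⟩ := hR.const_of_locally_const K fun e he => by
    rw [← sub_eq_zero, hK, ind_eq_zero_of_not_mem t he, ind_eq_zero_of_not_mem t₀ he, sub_self]
  refine ⟨fun v => K v - k, fun v hv => sub_eq_zero.2 (hk v hv), fun e => ?_⟩
  rw [sub_sub_sub_cancel_right, hK]

/-- The height function of the tiling `t`, relative to the tiling `t₀`. -/
noncomputable def height (hR : M.NoHoles R) (t₀ t : Tiling L R) : L.Site → ℤ :=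
  (hR.exists_height t₀ t).choose

variable {hR : M.NoHoles R} {t₀ : Tiling L R}

theorem height_eq_zero (t : Tiling L R) {v : L.Site} (hv : ¬ M.Interior R v) :
    height hR t₀ t v = 0 := (hR.exists_height t₀ t).choose_spec.1 v hv

theorem height_sub (t : Tiling L R) (e : M.E) :
    height hR t₀ t (M.tgt e) - height hR t₀ t (M.src e) = M.ind t e - M.ind t₀ e :=
  (hR.exists_height t₀ t).choose_spec.2 e

theorem eq_of_coboundary_eq {h h' : L.Site → ℤ} (h0 : ∀ v, ¬ M.Interior R v → h v = 0)
    (h0' : ∀ v, ¬ M.Interior R v → h' v = 0)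
    (H : ∀ e, h (M.tgt e) - h (M.src e) = h' (M.tgt e) - h' (M.src e)) : h = h' := by
  obtain ⟨v₀, hv₀⟩ := M.exists_not_interior R
  funext v
  have := M.const_of_coboundary_eq_zero (fun v => h v - h' v) (fun e => by linarith [H e]) v v₀
  simp only [h0 v₀ hv₀, h0' v₀ hv₀] at this
  linarith

theorem height_injective : Function.Injective (height hR t₀) := by
  intro t t' h
  refine ext_ind (M := M) fun e => ?_
  have h₁ := height_sub (hR := hR) (t₀ := t₀) t e
  rw [h, height_sub] at h₁
  linarith

/-- The functions on the vertices which are height functions of tilings. -/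
def IsHeight (M : PlanarModel L) (t₀ : Tiling L R) (h : L.Site → ℤ) : Prop :=
  (∀ v, ¬ M.Interior R v → h v = 0) ∧
    ∀ e, M.ind t₀ e + (h (M.tgt e) - h (M.src e)) = 0 ∨
      M.ind t₀ e + (h (M.tgt e) - h (M.src e)) = 1

theorem isHeight_height (t : Tiling L R) : M.IsHeight t₀ (height hR t₀ t) := by
  refine ⟨fun v hv => height_eq_zero t hv, fun e => ?_⟩
  rw [height_sub, add_sub_cancel]
  exact ind_eq_zero_or_one t e

/-- The prescribed edge function has values 0 and 1 and the same face sums as `t₀`, so each face of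
`R` has exactly one edge with value 1. It vanishes off `R`, since the ends of an edge not inside `R`
are not interior. -/
theorem IsHeight.exists_tiling {h : L.Site → ℤ} (hh : M.IsHeight t₀ h) :
    ∃ t : Tiling L R, ∀ e, M.ind t e = M.ind t₀ e + (h (M.tgt e) - h (M.src e)) := by
  classical
  set g : M.E → ℤ := fun e => M.ind t₀ e + (h (M.tgt e) - h (M.src e)) with hg
  have hmem : ∀ e, g e = 1 → M.left e ∈ R ∧ M.right e ∈ R := by
    intro e he
    by_contra hc
    obtain ⟨h1, h2⟩ := not_interior hc
    simp [hg, hh.1 _ h1, hh.1 _ h2, ind_eq_zero_of_not_mem t₀ hc] at he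
  have hsum : ∀ f ∈ R, ∑ e ∈ M.bdry f, g e = 1 := by
    intro f hf
    rw [Finset.sum_add_distrib, M.sum_coboundary, sum_ind, if_pos hf, add_zero]
  set T := (((R.biUnion M.bdry).filter fun e => g e = 1).image M.tile) with hT
  have memT : ∀ e, M.tile e ∈ T ↔ g e = 1 := by
    intro e
    simp only [hT, Finset.mem_image, Finset.mem_filter, Finset.mem_biUnion]
    constructor
    · rintro ⟨e', ⟨-, h1⟩, h2⟩
      exact tile_injective h2 ▸ h1
    · exact fun h1 => ⟨e, ⟨⟨M.left e, (hmem e h1).1, M.mem_bdry.2 (Or.inl rfl)⟩, h1⟩, rfl⟩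
  have exT : ∀ d ∈ T, ∃ e, d = M.tile e := by
    intro d hd
    obtain ⟨e, -, rfl⟩ := Finset.mem_image.1 hd
    exact ⟨e, rfl⟩
  refine ⟨⟨T, fun d hd => M.isTile_iff.2 (exT d hd), fun d hd f hf => ?_, fun f hf => ?_⟩,
    fun e => ?_⟩
  · obtain ⟨e, rfl⟩ := exT d hd
    obtain ⟨h1, h2⟩ := hmem e ((memT e).1 hd)
    rcases mem_tile.1 hf with rfl | rfl <;> assumption
  · have hcard : (((M.bdry f).filter fun e => g e = 1).card : ℤ) = 1 := by
      refine Eq.trans ?_ (hsum f hf)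
      rw [Finset.card_filter]
      push_cast
      refine Finset.sum_congr rfl fun e _ => ?_
      rcases hh.2 e with h1 | h1 <;> change g e = _ at h1 <;> simp [h1]
    obtain ⟨e, he⟩ := Finset.card_eq_one.1 (by exact_mod_cast hcard)
    have key : ∀ e', (e' ∈ M.bdry f ∧ g e' = 1) ↔ e' = e := by
      intro e'
      simpa using Finset.ext_iff.1 he e'
    obtain ⟨h1, h2⟩ := (key e).2 rfl
    refine ⟨M.tile e, ⟨(memT e).2 h2, mem_tile.2 (M.mem_bdry.1 h1)⟩, ?_⟩
    rintro d ⟨hd, hfd⟩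
    obtain ⟨e', rfl⟩ := exT d hd
    rw [(key e').1 ⟨M.mem_bdry.2 (mem_tile.1 hfd), (memT e').1 hd⟩]
  · change (if M.tile e ∈ T then (1 : ℤ) else 0) = g e
    simp only [memT]
    rcases hh.2 e with h1 | h1 <;> change g e = _ at h1 <;> simp [h1]

theorem IsHeight.exists_height_eq (hR : M.NoHoles R) {h : L.Site → ℤ} (hh : M.IsHeight t₀ h) :
    ∃ t : Tiling L R, height hR t₀ t = h := by
  obtain ⟨t, ht⟩ := hh.exists_tiling
  refine ⟨t, eq_of_coboundary_eq (fun v => height_eq_zero t) hh.1 fun e => ?_⟩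
  rw [height_sub, ht, add_sub_cancel_left]

/-- Being a height function is a condition on the pairs of adjacent vertices. -/
theorem IsHeight.of_local {g : L.Site → ℤ} (H : ∀ e, ∃ h, M.IsHeight t₀ h ∧
    h (M.src e) = g (M.src e) ∧ h (M.tgt e) = g (M.tgt e)) : M.IsHeight t₀ g := by
  constructor
  · intro v hv
    obtain ⟨e, he⟩ := M.out_nonempty v
    rw [M.mem_out] at he
    obtain ⟨h, hh, h1, -⟩ := H e
    rw [← he, ← h1]
    exact hh.1 _ (he ▸ hv)
  · intro e
    obtain ⟨h, hh, h1, h2⟩ := H e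
    rw [← h1, ← h2]
    exact hh.2 e

/-- On each edge the increment is confined to two consecutive integers, i.e. bounded below and
above; such bounds on differences survive minima and maxima. -/
theorem IsHeight.inf {h h' : L.Site → ℤ} (hh : M.IsHeight t₀ h) (hh' : M.IsHeight t₀ h') :
    M.IsHeight t₀ (h ⊓ h') := by
  refine ⟨fun v hv => by simp [hh.1 v hv, hh'.1 v hv], fun e => ?_⟩
  have := hh.2 e
  have := hh'.2 e
  simp only [Pi.inf_apply]
  omega

theorem IsHeight.sup {h h' : L.Site → ℤ} (hh : M.IsHeight t₀ h) (hh' : M.IsHeight t₀ h') :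
    M.IsHeight t₀ (h ⊔ h') := by
  refine ⟨fun v hv => by simp [hh.1 v hv, hh'.1 v hv], fun e => ?_⟩
  have := hh.2 e
  have := hh'.2 e
  simp only [Pi.sup_apply]
  omega


/-! ### Flips as unit changes of the height at one vertex -/

theorem tile_mem_filling_up {s : L.Site} {e : M.E} :
    M.tile e ∈ L.filling s (M.up s) ↔ M.src e = s := by
  rw [M.mem_filling_up]
  exact ⟨fun ⟨e', h, h'⟩ => (tile_injective (M := M) h') ▸ h, fun h => ⟨e, h, rfl⟩⟩

theorem tile_mem_filling_not_up {s : L.Site} {e : M.E} :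
    M.tile e ∈ L.filling s (!M.up s) ↔ M.tgt e = s := by
  rw [M.mem_filling_not_up]
  exact ⟨fun ⟨e', h, h'⟩ => (tile_injective (M := M) h') ▸ h, fun h => ⟨e, h, rfl⟩⟩

theorem bool_cases (M : PlanarModel L) (s : L.Site) (b : Bool) : b = M.up s ∨ b = !M.up s := by
  cases b <;> cases M.up s <;> simp

theorem exists_tile_of_mem_filling (M : PlanarModel L) {s : L.Site} {b : Bool} {d : Finset L.Face}
    (hd : d ∈ L.filling s b) : ∃ e, d = M.tile e := by
  rcases M.bool_cases s b with rfl | rfl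
  · obtain ⟨e, -, h⟩ := M.mem_filling_up.1 hd
    exact ⟨e, h⟩
  · obtain ⟨e, -, h⟩ := M.mem_filling_not_up.1 hd
    exact ⟨e, h⟩

theorem notMem_filling_not {s : L.Site} {b : Bool} {e : M.E} (he : M.tile e ∈ L.filling s b) :
    M.tile e ∉ L.filling s (!b) := by
  intro he'
  rcases M.bool_cases s b with rfl | rfl
  · exact M.src_ne_tgt e ((tile_mem_filling_up.1 he).trans (tile_mem_filling_not_up.1 he').symm)
  · rw [Bool.not_not] at he'
    exact M.src_ne_tgt e ((tile_mem_filling_up.1 he').trans (tile_mem_filling_not_up.1 he).symm)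

theorem filling_star {s : L.Site} {b : Bool} {f : L.Face} :
    (∃ e, M.tile e ∈ L.filling s b ∧ f ∈ M.tile e) ↔
      ∃ e, M.tile e ∈ L.filling s (!b) ∧ f ∈ M.tile e := by
  rcases M.bool_cases s b with rfl | rfl
  · simp only [tile_mem_filling_up, tile_mem_filling_not_up, mem_tile, M.star]
  · simp only [Bool.not_not, tile_mem_filling_up, tile_mem_filling_not_up, mem_tile, M.star]

theorem mem_support (b : Bool) {s : L.Site} {f : L.Face} :
    f ∈ support L s ↔ ∃ e, M.tile e ∈ L.filling s b ∧ f ∈ M.tile e := by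
  have h : f ∈ support L s ↔ ∃ e, M.tile e ∈ L.filling s false ∧ f ∈ M.tile e := by
    simp only [support, Finset.mem_biUnion, id]
    constructor
    · rintro ⟨d, hd, hf⟩
      obtain ⟨e, rfl⟩ := M.exists_tile_of_mem_filling hd
      exact ⟨e, hd, hf⟩
    · rintro ⟨e, he, hf⟩
      exact ⟨_, he, hf⟩
  cases b
  · exact h
  · exact h.trans filling_star

theorem tile_notMem_of_filling_subset {s : L.Site} {b : Bool} {t : Tiling L R}
    (hb : L.filling s b ⊆ t.tiles) {e : M.E} (he : M.tile e ∈ L.filling s (!b)) :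
    M.tile e ∉ t.tiles := by
  intro h
  obtain ⟨e', he', hf⟩ := filling_star.2 ⟨e, he, left_mem_tile e⟩
  obtain rfl := eq_of_common_face t h (hb he') (left_mem_tile e) hf
  exact notMem_filling_not he' he

theorem flip_iff_ind {s : L.Site} {b : Bool} {t t' : Tiling L R} :
    (L.filling s b ⊆ t.tiles ∧ t'.tiles = (t.tiles \ L.filling s b) ∪ L.filling s (!b)) ↔
      ∀ e, M.ind t' e - M.ind t e = (if M.tile e ∈ L.filling s (!b) then 1 else 0) -
        (if M.tile e ∈ L.filling s b then 1 else 0) := by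
  constructor
  · rintro ⟨hb, ht'⟩ e
    simp only [ind, ht', Finset.mem_union, Finset.mem_sdiff]
    by_cases h1 : M.tile e ∈ L.filling s (!b)
    · have h2 := tile_notMem_of_filling_subset hb h1
      have h3 : M.tile e ∉ L.filling s b := fun h => h2 (hb h)
      simp [h1, h2, h3]
    · by_cases h2 : M.tile e ∈ L.filling s b
      · simp [h1, h2, hb h2]
      · simp [h1, h2]
  · intro h
    have hb : L.filling s b ⊆ t.tiles := by
      intro d hd
      obtain ⟨e, rfl⟩ := M.exists_tile_of_mem_filling hd
      have := h e
      rw [if_neg (notMem_filling_not hd), if_pos hd] at this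
      rw [← ind_eq_one_iff]
      rcases ind_eq_zero_or_one t e with h1 | h1 <;>
        rcases ind_eq_zero_or_one t' e with h2 | h2 <;> omega
    refine ⟨hb, ?_⟩
    have key : ∀ e, M.tile e ∈ t'.tiles ↔
        M.tile e ∈ (t.tiles \ L.filling s b) ∪ L.filling s (!b) := by
      intro e
      have := h e
      rw [Finset.mem_union, Finset.mem_sdiff, ← ind_eq_one_iff, ← ind_eq_one_iff]
      by_cases h1 : M.tile e ∈ L.filling s (!b)
      · have h2 := tile_notMem_of_filling_subset hb h1
        have h3 : M.tile e ∉ L.filling s b := fun h => h2 (hb h)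
        rw [if_pos h1, if_neg h3, ind_eq_zero_iff.2 h2] at this
        simp only [h1, or_true, iff_true]
        omega
      · by_cases h2 : M.tile e ∈ L.filling s b
        · rw [if_neg h1, if_pos h2, ind_eq_one_iff.2 (hb h2)] at this
          simp only [h1, h2, not_true, and_false, or_false, iff_false]
          omega
        · rw [if_neg h1, if_neg h2] at this
          simp only [h1, h2, not_false_eq_true, and_true, or_false]
          omega
    ext d
    constructor
    · intro hd
      obtain ⟨e, rfl⟩ := exists_tile_eq (M := M) t' hd
      exact (key e).1 hd
    · intro hd
      obtain ⟨e, rfl⟩ : ∃ e, d = M.tile e := by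
        rcases Finset.mem_union.1 hd with hd | hd
        · exact exists_tile_eq t (Finset.mem_sdiff.1 hd).1
        · exact M.exists_tile_of_mem_filling hd
      exact (key e).2 hd

theorem interior_of_filling_subset {s : L.Site} {b : Bool} {t : Tiling L R}
    (hb : L.filling s b ⊆ t.tiles) : M.Interior R s := by
  have hR : ∀ f ∈ support L s, f ∈ R := by
    intro f hf
    obtain ⟨e, he, hf⟩ := (mem_support (M := M) b).1 hf
    exact t.subset _ (hb he) hf
  rintro e (he | he)
  · have := tile_mem_filling_up.2 he
    exact ⟨hR _ ((mem_support _).2 ⟨e, this, left_mem_tile e⟩),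
      hR _ ((mem_support _).2 ⟨e, this, right_mem_tile e⟩)⟩
  · have := tile_mem_filling_not_up.2 he
    exact ⟨hR _ ((mem_support _).2 ⟨e, this, left_mem_tile e⟩),
      hR _ ((mem_support _).2 ⟨e, this, right_mem_tile e⟩)⟩

theorem single_sub_single (s : L.Site) (σ : ℤ) (e : M.E) :
    (Pi.single s σ : L.Site → ℤ) (M.tgt e) - (Pi.single s σ : L.Site → ℤ) (M.src e) =
      σ * ((if M.tgt e = s then 1 else 0) - (if M.src e = s then 1 else 0)) := by
  simp only [Pi.single_apply]
  split_ifs <;> ring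

theorem height_eq_add_single_iff {s : L.Site} (σ : ℤ) {t t' : Tiling L R} (hs : M.Interior R s) :
    height hR t₀ t' = height hR t₀ t + Pi.single s σ ↔ ∀ e, M.ind t' e - M.ind t e =
      σ * ((if M.tgt e = s then 1 else 0) - (if M.src e = s then 1 else 0)) := by
  constructor
  · intro h e
    have h1 := height_sub (hR := hR) (t₀ := t₀) t' e
    rw [h, Pi.add_apply, Pi.add_apply, add_sub_add_comm, height_sub, single_sub_single] at h1
    linarith
  · intro h
    refine eq_of_coboundary_eq (fun v => height_eq_zero t') (fun v hv => ?_) fun e => ?_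
    · rw [Pi.add_apply, height_eq_zero t hv, Pi.single_eq_of_ne (fun h : v = s => hv (h ▸ hs)), add_zero]
    · rw [Pi.add_apply, Pi.add_apply, add_sub_add_comm, height_sub, height_sub, single_sub_single,
        ← h]
      ring

theorem interior_of_height_eq {s : L.Site} {σ : ℤ} (hσ : σ ≠ 0) {t t' : Tiling L R}
    (h : height hR t₀ t' = height hR t₀ t + Pi.single s σ) : M.Interior R s := by
  by_contra hs
  have := congrFun h s
  rw [Pi.add_apply, height_eq_zero t' hs, height_eq_zero t hs, Pi.single_eq_same] at this
  omega

/-- The coboundary of the indicator of `s` is `1` on the edges arriving at `s` and `-1` on those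
leaving it: exactly the change of the tile indicator when the filling across the leaving edges gives
way to the other one. -/
theorem up_flip_iff {s : L.Site} {t t' : Tiling L R} : (L.filling s (M.up s) ⊆ t.tiles ∧
    t'.tiles = (t.tiles \ L.filling s (M.up s)) ∪ L.filling s (!M.up s)) ↔
      height hR t₀ t' = height hR t₀ t + Pi.single s 1 := by
  constructor
  · intro h
    rw [height_eq_add_single_iff _ (interior_of_filling_subset h.1)]
    simpa only [tile_mem_filling_up, tile_mem_filling_not_up, one_mul] using (flip_iff_ind (M := M)).1 h
  · intro h
    rw [height_eq_add_single_iff _ (interior_of_height_eq one_ne_zero h)] at h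
    rw [flip_iff_ind (M := M)]
    simpa only [tile_mem_filling_up, tile_mem_filling_not_up, one_mul] using h

theorem down_flip_iff {s : L.Site} {t t' : Tiling L R} : (L.filling s (!M.up s) ⊆ t.tiles ∧
    t'.tiles = (t.tiles \ L.filling s (!M.up s)) ∪ L.filling s (!!M.up s)) ↔
      height hR t₀ t' = height hR t₀ t + Pi.single s (-1) := by
  constructor
  · intro h
    rw [height_eq_add_single_iff _ (interior_of_filling_subset h.1)]
    simpa only [Bool.not_not, tile_mem_filling_up, tile_mem_filling_not_up, neg_one_mul, neg_sub]
      using (flip_iff_ind (M := M)).1 h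
  · intro h
    rw [height_eq_add_single_iff _ (interior_of_height_eq (by norm_num) h)] at h
    rw [flip_iff_ind (M := M)]
    simpa only [Bool.not_not, tile_mem_filling_up, tile_mem_filling_not_up, neg_one_mul, neg_sub]
      using h

/-- A flip changes the height function by one at one vertex. -/
theorem isFlip_iff {s : L.Site} {t t' : Tiling L R} : IsFlip s t t' ↔
    ∃ σ : ℤ, (σ = 1 ∨ σ = -1) ∧ height hR t₀ t' = height hR t₀ t + Pi.single s σ := by
  constructor
  · rintro ⟨b, hb⟩
    rcases M.bool_cases s b with rfl | rfl
    · exact ⟨1, Or.inl rfl, up_flip_iff.1 hb⟩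
    · exact ⟨-1, Or.inr rfl, down_flip_iff.1 hb⟩
  · rintro ⟨σ, rfl | rfl, h⟩
    · exact ⟨_, up_flip_iff.2 h⟩
    · exact ⟨_, down_flip_iff.2 h⟩

theorem isFlip_symm (hR : M.NoHoles R) {s : L.Site} {t t' : Tiling L R} (h : IsFlip s t t') :
    IsFlip s t' t := by
  obtain ⟨σ, hσ, h⟩ := (isFlip_iff (hR := hR) (t₀ := t)).1 h
  refine (isFlip_iff (hR := hR) (t₀ := t)).2 ⟨-σ, by omega, ?_⟩
  rw [h, Pi.single_neg, add_neg_cancel_right]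

theorem adj_iff (hR : M.NoHoles R) {t t' : Tiling L R} :
    (flipGraph L R).Adj t t' ↔ ∃ s, IsFlip s t t' := by
  rw [flipGraph, SimpleGraph.fromRel_adj]
  constructor
  · rintro ⟨-, h | ⟨s, h⟩⟩
    · exact h
    · exact ⟨s, isFlip_symm hR h⟩
  · rintro ⟨s, h⟩
    refine ⟨?_, Or.inl ⟨s, h⟩⟩
    rintro rfl
    obtain ⟨σ, hσ, h⟩ := (isFlip_iff (hR := hR) (t₀ := t)).1 h
    have := congrFun h s
    rw [Pi.add_apply, Pi.single_eq_same] at this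
    omega

/-- A common face lies in only one tile of `t`, which must then belong to both fillings. -/
theorem exists_common_edge {u v : L.Site} {b b' : Bool} {t : Tiling L R}
    (hu : L.filling u b ⊆ t.tiles) (hv : L.filling v b' ⊆ t.tiles)
    (h : ¬ Disjoint (support L u) (support L v)) :
    ∃ e, M.tile e ∈ L.filling u b ∧ M.tile e ∈ L.filling v b' := by
  obtain ⟨f, hfu, hfv⟩ := Finset.not_disjoint_iff.1 h
  obtain ⟨e, he, hf⟩ := (mem_support (M := M) b).1 hfu
  obtain ⟨e', he', hf'⟩ := (mem_support (M := M) b').1 hfv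
  obtain rfl := eq_of_common_face t (hu he) (hv he') hf hf'
  exact ⟨e, he, he'⟩

theorem left_mem_support_src (e : M.E) : M.left e ∈ support L (M.src e) :=
  (mem_support _).2 ⟨e, tile_mem_filling_up.2 rfl, left_mem_tile e⟩

theorem left_mem_support_tgt (e : M.E) : M.left e ∈ support L (M.tgt e) :=
  (mem_support _).2 ⟨e, tile_mem_filling_not_up.2 rfl, left_mem_tile e⟩

/-- Flips at pairwise disjoint sites can be performed simultaneously. -/
theorem IsHeight.of_disjoint {h g : L.Site → ℤ} {S : Set L.Site} {σ : L.Site → ℤ}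
    (hS : S.PairwiseDisjoint (support L)) (hh : M.IsHeight t₀ h)
    (hσ : ∀ s ∈ S, M.IsHeight t₀ (h + Pi.single s (σ s)))
    (hg : ∀ v, g v = h v ∨ v ∈ S ∧ g v = h v + σ v) : M.IsHeight t₀ g := by
  refine .of_local fun e => ?_
  have hst := M.src_ne_tgt e
  rcases hg (M.src e) with h1 | ⟨hs1, h1⟩
  · rcases hg (M.tgt e) with h2 | ⟨hs2, h2⟩
    · exact ⟨h, hh, h1.symm, h2.symm⟩
    · refine ⟨_, hσ _ hs2, ?_, ?_⟩
      · rw [Pi.add_apply, Pi.single_eq_of_ne hst, add_zero, h1]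
      · rw [Pi.add_apply, Pi.single_eq_same, h2]
  · rcases hg (M.tgt e) with h2 | ⟨hs2, h2⟩
    · refine ⟨_, hσ _ hs1, ?_, ?_⟩
      · rw [Pi.add_apply, Pi.single_eq_same, h1]
      · rw [Pi.add_apply, Pi.single_eq_of_ne hst.symm, add_zero, h2]
    · exact absurd (left_mem_support_tgt e)
        (Finset.disjoint_left.1 (hS hs1 hs2 hst) (left_mem_support_src e))

theorem filling_subset_of_isHeight_add {h : L.Site → ℤ} {s : L.Site} {t : Tiling L R}
    (ht : height hR t₀ t = h) (h' : M.IsHeight t₀ (h + Pi.single s 1)) :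
    L.filling s (M.up s) ⊆ t.tiles := by
  obtain ⟨t', ht'⟩ := h'.exists_height_eq hR
  exact (up_flip_iff.2 (ht' ▸ ht ▸ rfl : height hR t₀ t' = height hR t₀ t + Pi.single s 1)).1

/-- The sites where a flip increases the height are disjoint. -/
theorem disjoint_of_isHeight_add (hR : M.NoHoles R) {h : L.Site → ℤ} {u v : L.Site}
    (hh : M.IsHeight t₀ h) (hu : M.IsHeight t₀ (h + Pi.single u 1))
    (hv : M.IsHeight t₀ (h + Pi.single v 1)) (huv : u ≠ v) :
    Disjoint (support L u) (support L v) := by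
  obtain ⟨t, ht⟩ := hh.exists_height_eq hR
  by_contra hd
  obtain ⟨e, h1, h2⟩ := exists_common_edge (filling_subset_of_isHeight_add ht hu)
    (filling_subset_of_isHeight_add ht hv) hd
  exact huv ((tile_mem_filling_up.1 h1).symm.trans (tile_mem_filling_up.1 h2))

theorem isHeight_add_of_filling_subset {t : Tiling L R} {s : L.Site} {b : Bool} {σ : ℤ}
    (hσ : b = M.up s ∧ σ = 1 ∨ b = (!M.up s) ∧ σ = -1) (hb : L.filling s b ⊆ t.tiles) :
    M.IsHeight t₀ (height hR t₀ t + Pi.single s σ) := by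
  have hs := interior_of_filling_subset (M := M) hb
  refine ⟨fun v hv => ?_, fun e => ?_⟩
  · rw [Pi.add_apply, height_eq_zero t hv, Pi.single_eq_of_ne (fun h : v = s => hv (h ▸ hs)),
      add_zero]
  · rw [Pi.add_apply, Pi.add_apply, add_sub_add_comm, single_sub_single, height_sub, ← add_assoc,
      add_sub_cancel]
    have h0 : M.tile e ∈ L.filling s b → M.ind t e = 1 := fun h => ind_eq_one_iff.2 (hb h)
    have h1 : M.tile e ∈ L.filling s (!b) → M.ind t e = 0 :=
      fun h => ind_eq_zero_iff.2 (tile_notMem_of_filling_subset hb h)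
    have h2 := ind_eq_zero_or_one t e
    rcases hσ with ⟨rfl, rfl⟩ | ⟨rfl, rfl⟩ <;>
      simp only [Bool.not_not, tile_mem_filling_up, tile_mem_filling_not_up] at h0 h1 <;>
      split_ifs with h3 h4 h4
    all_goals
      simp only [h3, h4, true_imp_iff] at h0 h1
      omega

/-- On the edges of a region without holes, the coboundary which is `1` on the sides of the tiles
and `1 - deg` on the edges crossed by tiles has a potential. -/
theorem NoHoles.exists_potential (hR : M.NoHoles R) (t : Tiling L R) : ∃ P : L.Site → ℝ,
    ∀ e, M.left e ∈ R ∨ M.right e ∈ R → P (M.tgt e) - P (M.src e) = 1 - M.deg * M.ind t e := by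
  classical
  choose! w hw hcurl using hR
  -- Around a face of `R` this sums to `deg - deg * 1 = 0`. Only the faces of `F`, outside `R` but
  -- bordering it, can have a nonzero sum, and subtracting multiples of their winding cochains makes
  -- the result closed without changing it on the edges of `R`. These cochains are complex, so the
  -- real part is taken at the end.
  set c : M.E → ℂ := fun e =>
    if M.left e ∈ R ∨ M.right e ∈ R then 1 - M.deg * (M.ind t e : ℂ) else 0 with hc
  set F : Finset L.Face := (R.biUnion M.bdry).biUnion M.tile \ R with hF
  obtain ⟨K, hK⟩ := M.exists_potential (fun e => c e - ∑ f ∈ F, (∑ e' ∈ M.bdry f, c e') * w f e) (by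
    intro f'
    have hsum : ∀ f ∈ F, ∑ e ∈ M.bdry f', (∑ e' ∈ M.bdry f, c e') * w f e =
        (∑ e' ∈ M.bdry f, c e') * if f' = f then 1 else 0 := fun f hf => by
      rw [← Finset.mul_sum, hcurl f (Finset.mem_sdiff.1 hf).2 f']
    rw [Finset.sum_sub_distrib, Finset.sum_comm (s := M.bdry f'), Finset.sum_congr rfl hsum]
    simp only [mul_ite, mul_one, mul_zero, Finset.sum_ite_eq]
    split_ifs with hf'
    · exact sub_self _
    rw [sub_zero]
    by_cases hR' : f' ∈ R
    · have h1 := sum_ind (M := M) t f'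
      rw [if_pos hR'] at h1
      have h2 : ∑ e ∈ M.bdry f', c e = ∑ e ∈ M.bdry f', (1 - M.deg * (M.ind t e : ℂ)) := by
        refine Finset.sum_congr rfl fun e he => if_pos ?_
        rcases M.mem_bdry.1 he with rfl | rfl <;> simp [hR']
      rw [h2, Finset.sum_sub_distrib, ← Finset.mul_sum, ← Int.cast_sum, h1, Finset.sum_const,
        M.card_bdry]
      simp
    · refine Finset.sum_eq_zero fun e he => if_neg fun h => hf' ?_
      refine Finset.mem_sdiff.2 ⟨Finset.mem_biUnion.2 ⟨e, Finset.mem_biUnion.2 ?_,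
        mem_tile.2 (M.mem_bdry.1 he)⟩, hR'⟩
      rcases h with h | h
      · exact ⟨_, h, M.mem_bdry.2 (Or.inl rfl)⟩
      · exact ⟨_, h, M.mem_bdry.2 (Or.inr rfl)⟩)
  refine ⟨fun v => (K v).re, fun e he => ?_⟩
  rw [← Complex.sub_re, hK, Finset.sum_eq_zero fun f hf => by
    rw [hw f (Finset.mem_sdiff.1 hf).2 e he, mul_zero], sub_zero]
  simp only [hc, if_pos he]
  simp

/-- If the height of `t` is not everywhere at least the height of `t'`, there is a flip of `t` which
increases the height at a vertex where it is smaller than the height of `t'`. -/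
theorem exists_up_flip (hR : M.NoHoles R) {h h' : L.Site → ℤ} (hh : M.IsHeight t₀ h)
    (hh' : M.IsHeight t₀ h') {v : L.Site} (hv : h v < h' v) :
    ∃ u, h u < h' u ∧ M.IsHeight t₀ (h + Pi.single u 1) := by
  obtain ⟨t, ht⟩ := hh.exists_tiling
  obtain ⟨P, hP⟩ := hR.exists_potential t
  have hint : ∀ u, h u < h' u → M.Interior R u := by
    intro u hu
    by_contra hc
    rw [hh.1 u hc, hh'.1 u hc] at hu
    exact lt_irrefl _ hu
  -- A vertex of maximal potential among those where `h` is too low. If a leaving edge were not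
  -- crossed by a tile of `t`, then `h` would be too low at its end as well, and the potential there
  -- larger by one. So all leaving edges are crossed and `u` can be flipped up.
  obtain ⟨u, hu, hmax⟩ := Set.exists_max_image {u | h u < h' u} P
    ((M.finite_interior R).subset hint) ⟨v, hv⟩
  change h u < h' u at hu
  have hout : ∀ e, M.src e = u → M.ind t e = 1 := by
    intro e he
    by_contra hne
    have h0 : M.ind t e = 0 := (ind_eq_zero_or_one t e).resolve_right hne
    have h1 := ht e
    have h2 := hh'.2 e
    have h3 : P (M.tgt e) ≤ P u := hmax (M.tgt e) <| by
      change h (M.tgt e) < h' (M.tgt e)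
      rw [he] at h1 h2
      omega
    have h4 := hP e (Or.inl (hint u hu e (Or.inl he)).1)
    rw [h0, he] at h4
    simp at h4
    linarith
  refine ⟨u, hu, ?_⟩
  have hth : height hR t₀ t = h := eq_of_coboundary_eq (fun v => height_eq_zero t) hh.1 fun e => by
    rw [height_sub, ht, add_sub_cancel_left]
  refine hth ▸ isHeight_add_of_filling_subset (Or.inl ⟨rfl, rfl⟩) fun d hd => ?_
  obtain ⟨e, rfl⟩ := M.exists_tile_of_mem_filling hd
  exact ind_eq_one_iff.1 (hout e (tile_mem_filling_up.1 hd))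

end PlanarModel
-- Flip distance and equivalence of geodesics
theorem Swap.cons {L : TileSystem} {R : Finset L.Face} {t u t' : Tiling L R}
    (h : (flipGraph L R).Adj t u) {p q : (flipGraph L R).Walk u t'} (hpq : Swap p q) :
    Swap (SimpleGraph.Walk.cons h p) (SimpleGraph.Walk.cons h q) := by
  obtain ⟨a, v, v', c, p₁, p₂, h₁, h₂, h₁', h₂', r, s, hd, f₁, f₂, f₃, f₄, rfl, rfl⟩ := hpq
  exact ⟨a, v, v', c, .cons h p₁, p₂, h₁, h₂, h₁', h₂', r, s, hd, f₁, f₂, f₃, f₄, rfl, rfl⟩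

theorem Equivalent.cons {L : TileSystem} {R : Finset L.Face} {t u t' : Tiling L R}
    (h : (flipGraph L R).Adj t u) {p q : (flipGraph L R).Walk u t'} (hpq : Equivalent p q) :
    Equivalent (SimpleGraph.Walk.cons h p) (SimpleGraph.Walk.cons h q) := by
  induction hpq with
  | rel p q hpq => exact .rel _ _ (hpq.cons h)
  | refl p => exact .refl _
  | symm p q _ ih => exact .symm _ _ ih
  | trans p q r _ _ ih₁ ih₂ => exact .trans _ _ _ ih₁ ih₂

namespace PlanarModel

variable {L : TileSystem} {M : PlanarModel L} {R : Finset L.Face} {hR : M.NoHoles R}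

/-- The `ℓ¹` distance of the height functions of two tilings. -/
noncomputable def heightDist (hR : M.NoHoles R) (t₀ t t' : Tiling L R) : ℕ :=
  ∑ v ∈ (M.finite_interior R).toFinset, (height hR t₀ t v - height hR t₀ t' v).natAbs

variable {t₀ : Tiling L R}

theorem heightDist_comm (t t' : Tiling L R) :
    heightDist hR t₀ t t' = heightDist hR t₀ t' t :=
  Finset.sum_congr rfl fun _ _ => by rw [← Int.natAbs_neg, neg_sub]

theorem eq_of_heightDist_eq_zero {t t' : Tiling L R} (h : heightDist hR t₀ t t' = 0) : t = t' := by
  refine height_injective (hR := hR) (t₀ := t₀) (funext fun v => ?_)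
  by_cases hv : M.Interior R v
  · have := Finset.sum_eq_zero_iff.1 h v ((M.finite_interior R).mem_toFinset.2 hv)
    omega
  · rw [height_eq_zero t hv, height_eq_zero t' hv]

/-- Only the summand at `s` changes; the equation is additive to avoid subtraction in `ℕ`. -/
theorem heightDist_add_single {s : L.Site} {σ : ℤ} (hσ : σ ≠ 0) {t u t' : Tiling L R}
    (h : height hR t₀ u = height hR t₀ t + Pi.single s σ) :
    heightDist hR t₀ t t' + (height hR t₀ t s + σ - height hR t₀ t' s).natAbs =
      heightDist hR t₀ u t' + (height hR t₀ t s - height hR t₀ t' s).natAbs := by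
  classical
  have hs : s ∈ (M.finite_interior R).toFinset :=
    (M.finite_interior R).mem_toFinset.2 (interior_of_height_eq hσ h)
  unfold heightDist
  rw [← Finset.add_sum_erase _ _ hs, ← Finset.add_sum_erase _ _ hs,
    Finset.sum_congr (g := fun v => (height hR t₀ u v - height hR t₀ t' v).natAbs) rfl
      fun v hv => by
        rw [h, Pi.add_apply, Pi.single_eq_of_ne (Finset.mem_erase.1 hv).1, add_zero]]
  rw [h, Pi.add_apply, Pi.single_eq_same]
  omega

theorem heightDist_le_of_adj {t u : Tiling L R} (t' : Tiling L R) (h : (flipGraph L R).Adj t u) :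
    heightDist hR t₀ t t' ≤ heightDist hR t₀ u t' + 1 := by
  obtain ⟨s, hs⟩ := (adj_iff hR).1 h
  obtain ⟨σ, hσ, h⟩ := (isFlip_iff (hR := hR) (t₀ := t₀)).1 hs
  have := heightDist_add_single (t' := t') (by omega) h
  omega

theorem heightDist_le_length {t t' : Tiling L R} (p : (flipGraph L R).Walk t t') :
    heightDist hR t₀ t t' ≤ p.length := by
  induction p with
  | nil => simp [heightDist]
  | cons h p ih =>
    rw [SimpleGraph.Walk.length_cons]
    exact (heightDist_le_of_adj _ h).trans (Nat.add_le_add_right ih 1)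

theorem exists_adj_of_height_lt {t t' : Tiling L R} {v : L.Site}
    (hv : height hR t₀ t v < height hR t₀ t' v) :
    ∃ u, (flipGraph L R).Adj t u ∧ heightDist hR t₀ t t' = heightDist hR t₀ u t' + 1 := by
  obtain ⟨s, hs, h⟩ := exists_up_flip hR (isHeight_height (hR := hR) t) (isHeight_height t') hv
  obtain ⟨u, hu⟩ := h.exists_height_eq hR
  refine ⟨u, (adj_iff hR).2 ⟨s, isFlip_iff.2 ⟨1, Or.inl rfl, hu⟩⟩, ?_⟩
  have := heightDist_add_single (t' := t') one_ne_zero hu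
  omega

theorem exists_walk_length_eq (t t' : Tiling L R) :
    ∃ p : (flipGraph L R).Walk t t', p.length = heightDist hR t₀ t t' := by
  induction hn : heightDist hR t₀ t t' generalizing t t' with
  | zero =>
    obtain rfl := eq_of_heightDist_eq_zero hn
    exact ⟨.nil, rfl⟩
  | succ n ih =>
    have hne : height hR t₀ t ≠ height hR t₀ t' := by
      intro h
      have h0 : heightDist hR t₀ t t' = 0 := by simp [heightDist, h]
      omega
    obtain ⟨v, hv⟩ := Function.ne_iff.1 hne
    rcases lt_or_gt_of_ne hv with hv | hv
    · obtain ⟨u, htu, hu⟩ := exists_adj_of_height_lt hv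
      obtain ⟨p, hp⟩ := ih u t' (by omega)
      exact ⟨.cons htu p, by rw [SimpleGraph.Walk.length_cons, hp]⟩
    -- Flips are only known to exist upwards, so here `t'` is raised and the walk is extended at its
    -- end.
    · obtain ⟨u, htu, hu⟩ := exists_adj_of_height_lt hv
      rw [heightDist_comm t', heightDist_comm u] at hu
      obtain ⟨p, hp⟩ := ih t u (by omega)
      exact ⟨p.concat htu.symm, by rw [SimpleGraph.Walk.length_concat, hp]⟩

theorem dist_eq_heightDist (t t' : Tiling L R) :
    (flipGraph L R).dist t t' = heightDist hR t₀ t t' := by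
  obtain ⟨p, hp⟩ := exists_walk_length_eq (hR := hR) (t₀ := t₀) t t'
  refine le_antisymm (hp ▸ SimpleGraph.dist_le p) ?_
  obtain ⟨q, hq⟩ := SimpleGraph.Reachable.exists_walk_length_eq_dist ⟨p⟩
  exact hq ▸ heightDist_le_length q

/-- Two different flips which bring a tiling nearer to the same tiling act on disjoint sites. -/
theorem disjoint_of_heightDist {t t' u u' : Tiling L R} {s s' : L.Site} {σ σ' : ℤ}
    (hσ : σ = 1 ∨ σ = -1) (hσ' : σ' = 1 ∨ σ' = -1)
    (hu : height hR t₀ u = height hR t₀ t + Pi.single s σ)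
    (hu' : height hR t₀ u' = height hR t₀ t + Pi.single s' σ')
    (hd : heightDist hR t₀ t t' = heightDist hR t₀ u t' + 1)
    (hd' : heightDist hR t₀ t t' = heightDist hR t₀ u' t' + 1) (hne : u ≠ u') :
    s ≠ s' ∧ Disjoint (support L s) (support L s') := by
  have h₁ := heightDist_add_single (t' := t') (by omega) hu
  have h₂ := heightDist_add_single (t' := t') (by omega) hu'
  have hss : s ≠ s' := by
    rintro rfl
    have : σ = σ' := by omega
    subst this
    exact hne (height_injective (hu.trans hu'.symm))
  -- A tile of `t` gives its edge the largest admissible height increment, and that of `t'` is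
  -- smaller by at most one. Having to raise the source and lower the target would require a drop of
  -- at least two.
  have hcross : ∀ e, M.tile e ∈ t.tiles →
      height hR t₀ t (M.src e) < height hR t₀ t' (M.src e) →
      height hR t₀ t' (M.tgt e) < height hR t₀ t (M.tgt e) → False := by
    intro e he h₃ h₄
    have h₅ := height_sub (hR := hR) (t₀ := t₀) t e
    have h₆ := height_sub (hR := hR) (t₀ := t₀) t' e
    rw [ind_eq_one_iff.2 he] at h₅
    have := ind_eq_zero_or_one t' e
    omega
  refine ⟨hss, ?_⟩
  by_contra hc
  have hup : ∀ {u : Tiling L R} {s}, height hR t₀ u = height hR t₀ t + Pi.single s 1 →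
      L.filling s (M.up s) ⊆ t.tiles := fun h => (up_flip_iff.2 h).1
  have hdown : ∀ {u : Tiling L R} {s}, height hR t₀ u = height hR t₀ t + Pi.single s (-1) →
      L.filling s (!M.up s) ⊆ t.tiles := fun h => (down_flip_iff.2 h).1
  rcases hσ with rfl | rfl <;> rcases hσ' with rfl | rfl
  · obtain ⟨e, he, he'⟩ := exists_common_edge (hup hu) (hup hu') hc
    exact hss ((tile_mem_filling_up.1 he).symm.trans (tile_mem_filling_up.1 he'))
  · obtain ⟨e, he, he'⟩ := exists_common_edge (hup hu) (hdown hu') hc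
    obtain rfl := tile_mem_filling_up.1 he
    obtain rfl := tile_mem_filling_not_up.1 he'
    exact hcross e (hup hu he) (by omega) (by omega)
  · obtain ⟨e, he, he'⟩ := exists_common_edge (hdown hu) (hup hu') hc
    obtain rfl := tile_mem_filling_not_up.1 he
    obtain rfl := tile_mem_filling_up.1 he'
    exact hcross e (hdown hu he) (by omega) (by omega)
  · obtain ⟨e, he, he'⟩ := exists_common_edge (hdown hu) (hdown hu') hc
    exact hss ((tile_mem_filling_not_up.1 he).symm.trans (tile_mem_filling_not_up.1 he'))

/-- If the first flips differ, their sites are disjoint and both can be performed, giving a tiling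
`c` two steps nearer to `t'`. With a geodesic from `c`, the induction hypothesis applies after each
first flip, and one exchange links the two routes to `c`. -/
theorem equivalent_of_length_eq (n : ℕ) {t t' : Tiling L R} (p q : (flipGraph L R).Walk t t')
    (hn : heightDist hR t₀ t t' = n) (hp : p.length = n) (hq : q.length = n) :
    Equivalent p q := by
  induction n generalizing t t' with
  | zero =>
    cases p with
    | nil =>
      cases q with
      | nil => exact .refl _
      | cons h q => simp at hq
    | cons h p => simp at hp
  | succ n ih =>
    cases p with
    | nil => simp at hp
    | @cons _ u _ hu p =>
    cases q with
    | nil => simp at hq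
    | @cons _ u' _ hu' q =>
    rw [SimpleGraph.Walk.length_cons, Nat.add_right_cancel_iff] at hp hq
    have hdu : heightDist hR t₀ u t' = n := le_antisymm (hp ▸ heightDist_le_length p)
      (by have := heightDist_le_of_adj (hR := hR) (t₀ := t₀) t' hu; omega)
    have hdu' : heightDist hR t₀ u' t' = n := le_antisymm (hq ▸ heightDist_le_length q)
      (by have := heightDist_le_of_adj (hR := hR) (t₀ := t₀) t' hu'; omega)
    by_cases huu : u = u'
    · subst huu
      exact (ih p q hdu hp hq).cons hu
    obtain ⟨s, hs⟩ := (adj_iff hR).1 hu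
    obtain ⟨s', hs'⟩ := (adj_iff hR).1 hu'
    obtain ⟨σ, hσ, hhu⟩ := (isFlip_iff (hR := hR) (t₀ := t₀)).1 hs
    obtain ⟨σ', hσ', hhu'⟩ := (isFlip_iff (hR := hR) (t₀ := t₀)).1 hs'
    obtain ⟨hss, hdisj⟩ := disjoint_of_heightDist (t' := t') hσ hσ' hhu hhu' (by omega) (by omega)
      huu
    have hc : M.IsHeight t₀ (height hR t₀ t + Pi.single s σ + Pi.single s' σ') := by
      refine IsHeight.of_disjoint (S := {s, s'}) (σ := fun v => if v = s then σ else σ') ?_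
        (isHeight_height (hR := hR) t) ?_ ?_
      · exact Set.PairwiseDisjoint.insert (Set.pairwiseDisjoint_singleton _ _)
          fun j hj _ => Set.mem_singleton_iff.1 hj ▸ hdisj
      · rintro v (rfl | rfl)
        · rw [if_pos rfl, ← hhu]
          exact isHeight_height u
        · rw [if_neg hss.symm, ← hhu']
          exact isHeight_height u'
      · intro v
        by_cases h₁ : v = s
        · subst h₁
          simp [hss]
        · by_cases h₂ : v = s'
          · subst h₂
            simp [h₁]
          · simp [h₁, h₂]
    obtain ⟨c, hc⟩ := hc.exists_height_eq hR
    have huc : height hR t₀ c = height hR t₀ u + Pi.single s' σ' := by rw [hc, hhu]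
    have huc' : height hR t₀ c = height hR t₀ u' + Pi.single s σ := by
      rw [hc, hhu', add_right_comm]
    have fuc : IsFlip s' u c := isFlip_iff.2 ⟨σ', hσ', huc⟩
    have fuc' : IsFlip s u' c := isFlip_iff.2 ⟨σ, hσ, huc'⟩
    have hdc : heightDist hR t₀ u t' = heightDist hR t₀ c t' + 1 := by
      have h₁ := heightDist_add_single (t' := t') (by omega) hhu'
      have h₂ := heightDist_add_single (t' := t') (by omega) huc
      have h₃ : height hR t₀ u s' = height hR t₀ t s' := by
        rw [hhu, Pi.add_apply, Pi.single_eq_of_ne hss.symm, add_zero]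
      rw [h₃] at h₂
      omega
    obtain ⟨r, hr⟩ := exists_walk_length_eq (hR := hR) (t₀ := t₀) c t'
    have auc := (adj_iff hR).2 ⟨s', fuc⟩
    have auc' := (adj_iff hR).2 ⟨s, fuc'⟩
    have e₁ := (ih p (.cons auc r) hdu hp (by rw [SimpleGraph.Walk.length_cons]; omega)).cons hu
    have e₂ := (ih (.cons auc' r) q hdu' (by rw [SimpleGraph.Walk.length_cons]; omega) hq).cons hu'
    exact .trans _ _ _ e₁ (.trans _ _ _ (.rel _ _ ⟨t, u, u', c, .nil, r, hu, auc, hu', auc', s, s',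
      hdisj, hs, fuc, hs', fuc', rfl, rfl⟩) e₂)

theorem equivalent_of_isGeodesic (hR : M.NoHoles R) {t t' : Tiling L R}
    (p q : (flipGraph L R).Walk t t') (hp : IsGeodesic p) (hq : IsGeodesic q) :
    Equivalent p q :=
  equivalent_of_length_eq (hR := hR) (t₀ := t) _ p q (dist_eq_heightDist t t').symm hp hq

end PlanarModel
-- Embedding the flip complex in the functions on the vertices
instance (L : TileSystem) (R : Finset L.Face) : Finite (Tiling L R) :=
  Finite.of_injective (β := {T // T ∈ R.powerset.powerset})
    (fun t => ⟨t.tiles, Finset.mem_powerset.2 fun d hd => Finset.mem_powerset.2 (t.subset d hd)⟩)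
    fun _ _ h => Tiling.ext (congrArg Subtype.val h)

namespace PlanarModel

variable {L : TileSystem} {M : PlanarModel L} {R : Finset L.Face}

theorem finite_cell (M : PlanarModel L) (R : Finset L.Face) : Finite (Cell L R) := by
  refine Finite.of_injective
    (β := Tiling L R × {S // S ∈ (M.finite_interior R).toFinset.powerset})
    (fun c => (c.corner, ⟨c.sites, Finset.mem_powerset.2 fun s hs =>
      (M.finite_interior R).mem_toFinset.2 (interior_of_filling_subset (c.flippable s hs))⟩)) ?_
  rintro ⟨c, S, h₁, h₂⟩ ⟨c', S', h₁', h₂'⟩ h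
  simp only [Prod.mk.injEq, Subtype.mk.injEq] at h
  obtain ⟨rfl, rfl⟩ := h
  rfl

/-- The change of height at the site `s` when its filling `false` is replaced by `true`. -/
def sgn (M : PlanarModel L) (s : L.Site) : ℤ := if M.up s = false then 1 else -1

theorem sgn_eq_or (M : PlanarModel L) (s : L.Site) : M.sgn s = 1 ∨ M.sgn s = -1 := by
  unfold sgn
  split_ifs <;> simp

theorem false_eq_or (M : PlanarModel L) (s : L.Site) :
    false = M.up s ∧ M.sgn s = 1 ∨ false = (!M.up s) ∧ M.sgn s = -1 := by
  unfold sgn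
  cases M.up s <;> simp

variable {hR : M.NoHoles R} {t₀ : Tiling L R}

theorem flip_false_iff {s : L.Site} {t t' : Tiling L R} : (L.filling s false ⊆ t.tiles ∧
    t'.tiles = (t.tiles \ L.filling s false) ∪ L.filling s true) ↔
      height hR t₀ t' = height hR t₀ t + Pi.single s (M.sgn s) := by
  rcases M.false_eq_or s with ⟨h₁, h₂⟩ | ⟨h₁, h₂⟩
  · rw [h₂, ← up_flip_iff, ← h₁, Bool.not_false]
  · rw [h₂, ← down_flip_iff, ← h₁, Bool.not_false]

theorem filling_false_subset_iff {s : L.Site} {t : Tiling L R} : L.filling s false ⊆ t.tiles ↔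
    M.IsHeight t₀ (height hR t₀ t + Pi.single s (M.sgn s)) := by
  constructor
  · exact isHeight_add_of_filling_subset (M.false_eq_or s)
  · intro h
    obtain ⟨t', ht'⟩ := h.exists_height_eq hR
    exact (flip_false_iff.2 ht').1

/-- `IsFlip` leaves the direction open. A site filled by `false` cannot also be filled by `true`, so
the flip in `Glue` has a definite sign. -/
theorem height_of_isFlip {s : L.Site} {t t' : Tiling L R} (hs : L.filling s false ⊆ t.tiles)
    (h : IsFlip s t t') : height hR t₀ t' = height hR t₀ t + Pi.single s (M.sgn s) := by
  obtain ⟨b, hb⟩ := h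
  cases b
  · exact flip_false_iff.1 hb
  · obtain ⟨e, he⟩ := M.out_nonempty s
    have h₁ := tile_mem_filling_up.2 (M.mem_out.1 he)
    obtain ⟨e', h₂, -⟩ := filling_star.1 ⟨e, h₁, left_mem_tile e⟩
    exfalso
    rcases M.bool_cases s false with hu | hu
    · rw [← hu] at h₁
      exact tile_notMem_of_filling_subset hb.1 h₁ (hs h₁)
    · rw [← hu] at h₂
      exact tile_notMem_of_filling_subset hb.1 h₂ (hs h₂)

/-- The map of the cubes to the euclidean space of real functions on the vertices which extends
the height functions affinely. -/
noncomputable def realize (hR : M.NoHoles R) (t₀ : Tiling L R) (p : Cubes L R) : L.Site → ℝ :=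
  fun s => height hR t₀ p.1.corner s +
    if hs : s ∈ p.1.sites then (M.sgn s : ℝ) * (p.2 ⟨s, hs⟩ : ℝ) else 0

theorem realize_of_mem {p : Cubes L R} {s : L.Site} (hs : s ∈ p.1.sites) :
    realize hR t₀ p s = height hR t₀ p.1.corner s + M.sgn s * (p.2 ⟨s, hs⟩ : ℝ) := by
  rw [realize, dif_pos hs]

theorem realize_of_notMem {p : Cubes L R} {s : L.Site} (hs : s ∉ p.1.sites) :
    realize hR t₀ p s = height hR t₀ p.1.corner s := by
  rw [realize, dif_neg hs, add_zero]

theorem realize_eq_of_glue {p q : Cubes L R} (h : Glue p q) :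
    realize hR t₀ p = realize hR t₀ q := by
  obtain ⟨s, hs, hsites, hx, hc⟩ := h
  funext v
  by_cases hv : v = s
  · subst hv
    rw [realize_of_mem hs, realize_of_notMem (p := q) (by simp [hsites])]
    rcases hc with ⟨h0, hc⟩ | ⟨h1, hc⟩
    · rw [h0, hc]
      simp
    · rw [h1, height_of_isFlip (p.1.flippable v hs) hc, Pi.add_apply, Pi.single_eq_same]
      simp
  · have hcv : height hR t₀ q.1.corner v = height hR t₀ p.1.corner v := by
      rcases hc with ⟨-, hc⟩ | ⟨-, hc⟩
      · rw [hc]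
      · rw [height_of_isFlip (p.1.flippable s hs) hc, Pi.add_apply, Pi.single_eq_of_ne hv, add_zero]
    by_cases hvp : v ∈ p.1.sites
    · have hvq : v ∈ q.1.sites := hsites ▸ Finset.mem_erase.2 ⟨hv, hvp⟩
      rw [realize_of_mem hvp, realize_of_mem hvq, hcv, hx v hvp hvq]
    · have hvq : v ∉ q.1.sites := fun h => hvp (Finset.mem_of_mem_erase (hsites ▸ h))
      rw [realize_of_notMem hvp, realize_of_notMem hvq, hcv]

theorem continuous_realize : Continuous (realize hR t₀) := by
  refine continuous_sigma fun c => continuous_pi fun s => ?_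
  by_cases hs : s ∈ c.sites
  · have : (fun x : c.sites → unitInterval => realize hR t₀ ⟨c, x⟩ s) = fun x =>
        (height hR t₀ c.corner s : ℝ) + M.sgn s * (x ⟨s, hs⟩ : ℝ) :=
      funext fun x => realize_of_mem (p := ⟨c, x⟩) hs
    rw [this]
    fun_prop
  · have : (fun x : c.sites → unitInterval => realize hR t₀ ⟨c, x⟩ s) = fun x =>
        (height hR t₀ c.corner s : ℝ) := funext fun x => realize_of_notMem (p := ⟨c, x⟩) hs
    rw [this]
    fun_prop

/-- Every point of the complex lies in the interior of a cube. -/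
theorem exists_mem_open_cube (hR : M.NoHoles R) (p : Cubes L R) : ∃ q : Cubes L R,
    Quot.mk Glue p = Quot.mk Glue q ∧ ∀ s, 0 < (q.2 s : ℝ) ∧ (q.2 s : ℝ) < 1 := by
  induction hn : p.1.sites.card generalizing p with
  | zero =>
    refine ⟨p, rfl, fun s => ?_⟩
    have := s.2
    simp [Finset.card_eq_zero.1 hn] at this
  | succ n ih =>
    by_cases hp : ∀ s, 0 < (p.2 s : ℝ) ∧ (p.2 s : ℝ) < 1
    · exact ⟨p, rfl, hp⟩
    obtain ⟨⟨s, hs⟩, hps⟩ := not_forall.1 hp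
    have hcard : (p.1.sites.erase s).card = n := by
      rw [Finset.card_erase_of_mem hs, hn, Nat.add_sub_cancel]
    have hind : ((p.1.sites.erase s : Finset L.Site) : Set L.Site).PairwiseDisjoint (support L) :=
      p.1.independent.subset (Finset.coe_subset.2 (Finset.erase_subset _ _))
    have hcase : p.2 ⟨s, hs⟩ = 0 ∨ p.2 ⟨s, hs⟩ = 1 := by
      by_contra! hc
      exact hps ⟨lt_of_le_of_ne (p.2 ⟨s, hs⟩).2.1 fun h => hc.1 (Subtype.ext h.symm),
        lt_of_le_of_ne (p.2 ⟨s, hs⟩).2.2 fun h => hc.2 (Subtype.ext h)⟩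
    rcases hcase with h0 | h1
    · set q : Cubes L R := ⟨⟨p.1.corner, p.1.sites.erase s,
        fun r hr => p.1.flippable r (Finset.mem_of_mem_erase hr), hind⟩,
        fun r => p.2 ⟨r, Finset.mem_of_mem_erase r.2⟩⟩ with hq
      obtain ⟨q', hq', h⟩ := ih q hcard
      exact ⟨q', (Quot.sound ⟨s, hs, rfl, fun _ _ _ => rfl, Or.inl ⟨h0, rfl⟩⟩).trans hq', h⟩
    · obtain ⟨t', ht'⟩ := ((filling_false_subset_iff (hR := hR) (t₀ := p.1.corner)).1
        (p.1.flippable s hs)).exists_height_eq hR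
      have hflip := flip_false_iff.2 ht'
      -- Disjointness of the sites keeps the tiles of the remaining sites in place after the flip at
      -- `s`.
      have hfl : ∀ r ∈ p.1.sites.erase s, L.filling r false ⊆ t'.tiles := by
        intro r hr d hd
        rw [hflip.2]
        refine Finset.mem_union_left _ (Finset.mem_sdiff.2
          ⟨p.1.flippable r (Finset.mem_of_mem_erase hr) hd, fun hd' => ?_⟩)
        obtain ⟨e, rfl⟩ := M.exists_tile_of_mem_filling hd
        exact Finset.disjoint_left.1 (p.1.independent (Finset.mem_of_mem_erase hr) hs
          (Finset.ne_of_mem_erase hr)) ((mem_support (M := M) false).2 ⟨e, hd, left_mem_tile e⟩)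
          ((mem_support (M := M) false).2 ⟨e, hd', left_mem_tile e⟩)
      set q : Cubes L R := ⟨⟨t', p.1.sites.erase s, hfl, hind⟩,
        fun r => p.2 ⟨r, Finset.mem_of_mem_erase r.2⟩⟩ with hq
      obtain ⟨q', hq', h⟩ := ih q hcard
      exact ⟨q', (Quot.sound ⟨s, hs, rfl, fun _ _ _ => rfl,
        Or.inr ⟨h1, false, hflip⟩⟩).trans hq', h⟩

/-- In an open cube the sites are precisely the vertices with nonintegral value. There the sign
depends only on the site, so the heights of the two corners differ by less than one and hence agree.
-/
theorem eq_of_realize_eq {p q : Cubes L R} (hp : ∀ s, 0 < (p.2 s : ℝ) ∧ (p.2 s : ℝ) < 1)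
    (hq : ∀ s, 0 < (q.2 s : ℝ) ∧ (q.2 s : ℝ) < 1) (h : realize hR t₀ p = realize hR t₀ q) :
    p = q := by
  have hsub : ∀ {p q : Cubes L R}, (∀ s, 0 < (p.2 s : ℝ) ∧ (p.2 s : ℝ) < 1) →
      realize hR t₀ p = realize hR t₀ q → p.1.sites ⊆ q.1.sites := by
    intro p q hp h s hs
    by_contra hsq
    have hv := congrFun h s
    rw [realize_of_mem hs, realize_of_notMem hsq] at hv
    obtain ⟨h0, h1⟩ := hp ⟨s, hs⟩
    rcases M.sgn_eq_or s with hσ | hσ <;> rw [hσ] at hv <;> push_cast at hv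
    · have h2 : (height hR t₀ p.1.corner s : ℝ) < height hR t₀ q.1.corner s := by linarith
      have h3 : (height hR t₀ q.1.corner s : ℝ) < height hR t₀ p.1.corner s + 1 := by linarith
      norm_cast at h2 h3
      omega
    · have h2 : (height hR t₀ q.1.corner s : ℝ) < height hR t₀ p.1.corner s := by linarith
      have h3 : (height hR t₀ p.1.corner s : ℝ) < height hR t₀ q.1.corner s + 1 := by linarith
      norm_cast at h2 h3
      omega
  have hsites : p.1.sites = q.1.sites := (hsub hp h).antisymm (hsub hq h.symm)
  have hcorner : p.1.corner = q.1.corner := by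
    refine height_injective (hR := hR) (t₀ := t₀) (funext fun s => ?_)
    have hv := congrFun h s
    by_cases hs : s ∈ p.1.sites
    · have hs' : s ∈ q.1.sites := hsites ▸ hs
      rw [realize_of_mem hs, realize_of_mem hs'] at hv
      obtain ⟨h0, h1⟩ := hp ⟨s, hs⟩
      obtain ⟨h0', h1'⟩ := hq ⟨s, hs'⟩
      have h2 : (height hR t₀ p.1.corner s : ℝ) < height hR t₀ q.1.corner s + 1 := by
        rcases M.sgn_eq_or s with hσ | hσ <;> rw [hσ] at hv <;> push_cast at hv <;> linarith
      have h3 : (height hR t₀ q.1.corner s : ℝ) < height hR t₀ p.1.corner s + 1 := by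
        rcases M.sgn_eq_or s with hσ | hσ <;> rw [hσ] at hv <;> push_cast at hv <;> linarith
      norm_cast at h2 h3
      omega
    · rw [realize_of_notMem hs, realize_of_notMem (hsites ▸ hs)] at hv
      exact_mod_cast hv
  obtain ⟨⟨c, S, hS, hS'⟩, x⟩ := p
  obtain ⟨⟨c', S', hT, hT'⟩, y⟩ := q
  dsimp only at hsites hcorner
  subst hsites hcorner
  refine Sigma.ext rfl (heq_of_eq (funext fun s => Subtype.ext ?_))
  have hv := congrFun h s
  rw [realize_of_mem (p := ⟨⟨c, S, hS, hS'⟩, x⟩) s.2,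
    realize_of_mem (p := ⟨⟨c, S, hT, hT'⟩, y⟩) s.2] at hv
  have hσ : (M.sgn s : ℝ) ≠ 0 := by
    rcases M.sgn_eq_or s with hσ | hσ <;> rw [hσ] <;> norm_num
  exact mul_left_cancel₀ hσ (add_left_cancel hv)

/-- The image of the flip complex in the space of real functions on the vertices. -/
def realization (M : PlanarModel L) (t₀ : Tiling L R) : Set (L.Site → ℝ) :=
  {y | M.IsHeight t₀ (fun v => ⌊y v⌋) ∧
    ∀ u, Int.fract (y u) ≠ 0 → M.IsHeight t₀ ((fun v => ⌊y v⌋) + Pi.single u 1)}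

/-- In an open cube the floor is the lowest corner: below the recorded corner by one at the sites of
sign `-1`. It and its raising at any one site both come from the recorded corner by some of the
cube's flips. -/
theorem realize_mem_realization (p : Cubes L R) : realize hR t₀ p ∈ M.realization t₀ := by
  obtain ⟨q, hq, h⟩ := exists_mem_open_cube hR p
  have hpq : realize hR t₀ p = realize hR t₀ q :=
    congrArg (Quot.lift (realize hR t₀) fun _ _ => realize_eq_of_glue) hq
  rw [hpq]
  clear hpq hq p
  set y := realize hR t₀ q with hy
  have hint : ∀ s ∉ q.1.sites, ⌊y s⌋ = height hR t₀ q.1.corner s ∧ Int.fract (y s) = 0 := by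
    intro s hs
    rw [hy, realize_of_notMem hs]
    exact ⟨Int.floor_intCast _, Int.fract_intCast _⟩
  have hfl : ∀ s ∈ q.1.sites, M.sgn s = 1 ∧ ⌊y s⌋ = height hR t₀ q.1.corner s ∨
      M.sgn s = -1 ∧ ⌊y s⌋ = height hR t₀ q.1.corner s - 1 := by
    intro s hs
    obtain ⟨h0, h1⟩ := h ⟨s, hs⟩
    rw [hy, realize_of_mem hs]
    rcases M.sgn_eq_or s with hσ | hσ
    · refine Or.inl ⟨hσ, ?_⟩
      rw [hσ, Int.floor_eq_iff]
      push_cast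
      constructor <;> linarith
    · refine Or.inr ⟨hσ, ?_⟩
      rw [hσ, Int.floor_eq_iff]
      push_cast
      constructor <;> linarith
  have hσ : ∀ s ∈ (q.1.sites : Set L.Site),
      M.IsHeight t₀ (height hR t₀ q.1.corner + Pi.single s (M.sgn s)) :=
    fun s hs => filling_false_subset_iff.1 (q.1.flippable s hs)
  refine ⟨.of_disjoint q.1.independent (isHeight_height q.1.corner) hσ fun v => ?_, fun u hu =>
    .of_disjoint q.1.independent (isHeight_height q.1.corner) hσ fun v => ?_⟩
  · by_cases hv : v ∈ q.1.sites
    · have := hfl v hv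
      simp only [Finset.mem_coe, hv, true_and]
      omega
    · exact Or.inl (hint v hv).1
  · have hus : u ∈ q.1.sites := by
      by_contra hus
      exact hu (hint u hus).2
    rw [Pi.add_apply]
    by_cases huv : v = u
    · subst huv
      have := hfl v hus
      simp only [Finset.mem_coe, hus, true_and, Pi.single_eq_same]
      omega
    · rw [Pi.single_eq_of_ne huv, add_zero]
      by_cases hv : v ∈ q.1.sites
      · have := hfl v hv
        simp only [Finset.mem_coe, hv, true_and]
        omega
      · exact Or.inl (hint v hv).1

theorem exists_realize_eq (hR : M.NoHoles R) {y : L.Site → ℝ} (hy : y ∈ M.realization t₀) :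
    ∃ p : Cubes L R, realize hR t₀ p = y := by
  classical
  obtain ⟨hfl, hup⟩ := hy
  have hfin : {u | Int.fract (y u) ≠ 0}.Finite := by
    refine (M.finite_interior R).subset fun u hu => ?_
    by_contra hc
    have h1 := (hup u hu).1 u hc
    have h2 : ⌊y u⌋ = 0 := hfl.1 u hc
    simp only [Pi.add_apply, Pi.single_eq_same] at h1
    omega
  have hdis : {u | Int.fract (y u) ≠ 0}.PairwiseDisjoint (support L) := fun u hu v hv huv =>
    disjoint_of_isHeight_add hR hfl (hup u hu) (hup v hv) huv
  -- The recorded corner has all sites filled by `false`; at a site of sign `-1` this is the upper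
  -- end, hence floor plus one, and the cube coordinate is one minus the fractional part.
  set g : L.Site → ℤ := fun v => if Int.fract (y v) ≠ 0 ∧ M.sgn v = -1 then ⌊y v⌋ + 1 else ⌊y v⌋
    with hg
  have hgH : M.IsHeight t₀ g := by
    refine .of_disjoint (σ := fun _ => 1) hdis hfl hup fun v => ?_
    simp only [hg, Set.mem_ofPred_eq]
    split_ifs with h
    · exact Or.inr ⟨h.1, rfl⟩
    · exact Or.inl rfl
  have hgσ : ∀ s, Int.fract (y s) ≠ 0 → M.IsHeight t₀ (g + Pi.single s (M.sgn s)) := by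
    intro s hs
    refine .of_disjoint (σ := fun _ => 1) hdis hfl hup fun v => ?_
    rw [Pi.add_apply]
    by_cases hv : v = s
    · subst hv
      have := M.sgn_eq_or v
      simp only [hg, Set.mem_ofPred_eq, hs, Pi.single_eq_same, ne_eq, not_false_eq_true, true_and]
      split_ifs <;> omega
    · rw [Pi.single_eq_of_ne hv, add_zero]
      simp only [hg, Set.mem_ofPred_eq]
      split_ifs with h
      · exact Or.inr ⟨h.1, rfl⟩
      · exact Or.inl rfl
  obtain ⟨c, hc⟩ := hgH.exists_height_eq hR
  set frac : L.Site → unitInterval := fun s =>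
    ⟨Int.fract (y s), Int.fract_nonneg _, (Int.fract_lt_one _).le⟩ with hfrac
  have hflip : ∀ s ∈ hfin.toFinset, L.filling s false ⊆ c.tiles := by
    intro s hs
    rw [filling_false_subset_iff (hR := hR) (t₀ := t₀), hc]
    exact hgσ s (hfin.mem_toFinset.1 hs)
  refine ⟨⟨⟨c, hfin.toFinset, hflip, by simpa using hdis⟩,
    fun s => if M.sgn s = 1 then frac s else unitInterval.symm (frac s)⟩, funext fun s => ?_⟩
  have hcs := congrFun hc s
  have hy := Int.floor_add_fract (y s)
  by_cases hs : Int.fract (y s) ≠ 0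
  · rw [realize_of_mem (hfin.mem_toFinset.2 hs)]
    change ((height hR t₀ c s : ℤ) : ℝ) + M.sgn s *
      ((if M.sgn s = 1 then frac s else unitInterval.symm (frac s) : unitInterval) : ℝ) = y s
    rw [hcs]
    rcases M.sgn_eq_or s with hσ | hσ
    · simp [hg, hσ, hfrac]
    · simp only [hg, hs, hσ, and_self, if_true, ne_eq, not_false_eq_true]
      rw [if_neg (by norm_num), unitInterval.coe_symm_eq]
      push_cast
      linarith
  · rw [realize_of_notMem (fun h => hs (hfin.mem_toFinset.1 h))]
    change ((height hR t₀ c s : ℤ) : ℝ) = y s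
    rw [hcs]
    simp only [hg, hs, false_and, if_false]
    rw [not_not.1 hs, add_zero] at hy
    exact hy

/-- The flip complex is homeomorphic to its image in the space of real functions. -/
noncomputable def complexHomeomorph (hR : M.NoHoles R) (t₀ : Tiling L R) :
    Complex L R ≃ₜ M.realization t₀ :=
  haveI := M.finite_cell R
  -- There are finitely many cells, so the complex is compact, and a continuous bijection onto a
  -- Hausdorff space suffices.
  Continuous.homeoOfEquivCompactToT2 (f := Equiv.ofBijective
    (Quot.lift (fun p => (⟨realize hR t₀ p, realize_mem_realization p⟩ : M.realization t₀))
      fun _ _ h => Subtype.ext (realize_eq_of_glue h)) ⟨by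
        rintro ⟨p⟩ ⟨q⟩ h
        obtain ⟨p', hp, hp'⟩ := exists_mem_open_cube hR p
        obtain ⟨q', hq, hq'⟩ := exists_mem_open_cube hR q
        rw [hp, hq] at h ⊢
        exact congrArg _ (eq_of_realize_eq hp' hq' (congrArg Subtype.val h)), by
        rintro ⟨y, hy⟩
        obtain ⟨p, hp⟩ := exists_realize_eq hR hy
        exact ⟨Quot.mk _ p, Subtype.ext hp⟩⟩)
    (continuous_quot_lift _ (continuous_realize.subtype_mk _))

end PlanarModel
-- Contracting the realization by minima
namespace PlanarModel

variable {L : TileSystem} {M : PlanarModel L} {R : Finset L.Face} {t₀ : Tiling L R}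

theorem finite_isHeight (hR : M.NoHoles R) : Finite {h // M.IsHeight t₀ h} := by
  refine Finite.of_surjective (α := Tiling L R) (fun t => ⟨height hR t₀ t, isHeight_height t⟩) ?_
  rintro ⟨h, hh⟩
  obtain ⟨t, ht⟩ := hh.exists_height_eq hR
  exact ⟨t, Subtype.ext ht⟩

theorem exists_max_height (hR : M.NoHoles R) (t₀ : Tiling L R) :
    ∃ m, M.IsHeight t₀ m ∧ ∀ h, M.IsHeight t₀ h → h ≤ m := by
  have := finite_isHeight (t₀ := t₀) hR
  have : Nonempty {h // M.IsHeight t₀ h} := ⟨⟨_, isHeight_height (hR := hR) t₀⟩⟩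
  have : IsDirected {h // M.IsHeight t₀ h} (· ≤ ·) :=
    ⟨fun a b => ⟨⟨_, a.2.sup b.2⟩, le_sup_left (a := a.1), le_sup_right (b := b.1)⟩⟩
  obtain ⟨m, hm⟩ := Finite.exists_le (id : {h // M.IsHeight t₀ h} → _)
  exact ⟨m.1, m.2, fun h hh => hm ⟨h, hh⟩⟩

theorem exists_min_height (hR : M.NoHoles R) (t₀ : Tiling L R) :
    ∃ m, M.IsHeight t₀ m ∧ ∀ h, M.IsHeight t₀ h → m ≤ h := by
  have := finite_isHeight (t₀ := t₀) hR
  have : Nonempty {h // M.IsHeight t₀ h} := ⟨⟨_, isHeight_height (hR := hR) t₀⟩⟩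
  have : IsDirected {h // M.IsHeight t₀ h} (· ≥ ·) :=
    ⟨fun a b => ⟨⟨_, a.2.inf b.2⟩, inf_le_left (a := a.1), inf_le_right (b := b.1)⟩⟩
  obtain ⟨m, hm⟩ := Finite.exists_ge (id : {h // M.IsHeight t₀ h} → _)
  exact ⟨m.1, m.2, fun h hh => hm ⟨h, hh⟩⟩

/-- If the floors at `u` differ, raising only that of `y` raises the minimum. If they agree, `z u`
is nonintegral too, and both may be raised. -/
theorem isHeight_floor_inf_add_single {y z : L.Site → ℝ} (hy : y ∈ M.realization t₀)
    (hz : z ∈ M.realization t₀) {u : L.Site} (hu : Int.fract (y u) ≠ 0) (hyz : y u ≤ z u) :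
    M.IsHeight t₀ (((fun v => ⌊y v⌋) ⊓ fun v => ⌊z v⌋) + Pi.single u 1) := by
  have hfl : ⌊y u⌋ ≤ ⌊z u⌋ := Int.floor_mono hyz
  rcases hfl.lt_or_eq with hlt | heq
  · convert (hy.2 u hu).inf hz.1 using 1
    funext v
    simp only [Pi.add_apply, Pi.inf_apply]
    by_cases hv : v = u
    · subst hv
      rw [Pi.single_eq_same]
      omega
    · rw [Pi.single_eq_of_ne hv, add_zero, add_zero]
  · have hzu : Int.fract (z u) ≠ 0 := by
      have h1 := Int.floor_add_fract (y u)
      have h2 := Int.floor_add_fract (z u)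
      have h3 := lt_of_le_of_ne (Int.fract_nonneg (y u)) hu.symm
      have h4 : (⌊y u⌋ : ℝ) = ⌊z u⌋ := by rw [heq]
      intro h
      linarith
    convert (hy.2 u hu).inf (hz.2 u hzu) using 1
    funext v
    simp only [Pi.add_apply, Pi.inf_apply]
    omega

theorem inf_mem_realization {y z : L.Site → ℝ} (hy : y ∈ M.realization t₀)
    (hz : z ∈ M.realization t₀) : y ⊓ z ∈ M.realization t₀ := by
  have hfl : (fun v => ⌊(y ⊓ z) v⌋) = (fun v => ⌊y v⌋) ⊓ fun v => ⌊z v⌋ :=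
    funext fun v => Int.floor_mono.map_inf _ _
  refine ⟨hfl ▸ hy.1.inf hz.1, fun u hu => ?_⟩
  rw [hfl]
  rw [Pi.inf_apply] at hu
  rcases le_total (y u) (z u) with h | h
  · exact isHeight_floor_inf_add_single hy hz (by rwa [inf_eq_left.2 h] at hu) h
  · rw [inf_comm]
    exact isHeight_floor_inf_add_single hz hy (by rwa [inf_eq_right.2 h] at hu) h

theorem add_smul_single_mem_realization {h : L.Site → ℤ} {u : L.Site} (hh : M.IsHeight t₀ h)
    (hu : M.IsHeight t₀ (h + Pi.single u 1)) {c : ℝ} (h0 : 0 ≤ c) (h1 : c ≤ 1) :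
    (fun v => (h v : ℝ) + if v = u then c else 0) ∈ M.realization t₀ := by
  have hne : ∀ v ≠ u, (h v : ℝ) + (if v = u then c else 0) = h v := fun v hv => by
    rw [if_neg hv, add_zero]
  -- At `c = 1` the floor jumps to the raised height, so this end is separate.
  rcases h1.lt_or_eq with h1 | rfl
  · have hfl : (fun v => ⌊(h v : ℝ) + if v = u then c else 0⌋) = h := by
      funext v
      rw [Int.floor_eq_iff]
      split_ifs <;> constructor <;> linarith
    refine ⟨hfl.symm ▸ hh, fun v hv => ?_⟩
    rw [hfl]
    beta_reduce at hv
    by_cases hvu : v = u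
    · exact hvu ▸ hu
    · rw [hne v hvu, Int.fract_intCast] at hv
      exact absurd rfl hv
  · have hint : ∀ v, (h v : ℝ) + (if v = u then 1 else 0) = ((h + Pi.single u 1 : L.Site → ℤ) v : ℝ) := by
      intro v
      rw [Pi.add_apply, Pi.single_apply]
      push_cast
      rfl
    have hfl : (fun v => ⌊(h v : ℝ) + if v = u then 1 else 0⌋) = h + Pi.single u 1 := by
      funext v
      rw [hint, Int.floor_intCast]
    refine ⟨hfl.symm ▸ hu, fun v hv => ?_⟩
    beta_reduce at hv
    rw [hint, Int.fract_intCast] at hv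
    exact absurd rfl hv

theorem intCast_mem_realization {h : L.Site → ℤ} (hh : M.IsHeight t₀ h) :
    (fun v => (h v : ℝ)) ∈ M.realization t₀ := by
  refine ⟨by simpa only [Int.floor_intCast] using hh, fun u hu => ?_⟩
  rw [Int.fract_intCast] at hu
  exact absurd rfl hu

theorem joinedIn_add_single {h : L.Site → ℤ} {u : L.Site} (hh : M.IsHeight t₀ h)
    (hu : M.IsHeight t₀ (h + Pi.single u 1)) : JoinedIn (M.realization t₀) (fun v => (h v : ℝ))
      (fun v => ((h + Pi.single u 1 : L.Site → ℤ) v : ℝ)) := by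
  refine JoinedIn.ofLine (f := fun c v => (h v : ℝ) + if v = u then c else 0) ?_ ?_ ?_ ?_
  · refine Continuous.continuousOn (continuous_pi fun v => ?_)
    split_ifs <;> fun_prop
  · simp
  · funext v
    simp [Pi.single_apply]
  · rintro _ ⟨c, hc, rfl⟩
    exact add_smul_single_mem_realization hh hu hc.1 hc.2

/-- `exists_up_flip` raises `h` one vertex at a time without exceeding `h'`; each raise is an edge
of the realization. -/
theorem joinedIn_of_le (hR : M.NoHoles R) {h h' : L.Site → ℤ} (hh : M.IsHeight t₀ h)
    (hh' : M.IsHeight t₀ h') (hle : h ≤ h') :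
    JoinedIn (M.realization t₀) (fun v => (h v : ℝ)) (fun v => (h' v : ℝ)) := by
  obtain ⟨n, hn⟩ : ∃ n : ℕ, ∑ v ∈ (M.finite_interior R).toFinset, (h' v - h v) ≤ n :=
    ⟨_, Int.self_le_toNat _⟩
  induction n generalizing h with
  | zero =>
    obtain rfl : h = h' := by
      funext v
      by_cases hv : M.Interior R v
      · have h0 : ∀ v ∈ (M.finite_interior R).toFinset, 0 ≤ h' v - h v :=
          fun v _ => sub_nonneg.2 (hle v)
        have := Finset.single_le_sum h0 ((M.finite_interior R).mem_toFinset.2 hv)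
        have : h v ≤ h' v := hle v
        push_cast at hn
        omega
      · rw [hh.1 v hv, hh'.1 v hv]
    exact JoinedIn.refl (intCast_mem_realization hh)
  | succ n ih =>
    by_cases heq : h = h'
    · subst heq
      exact JoinedIn.refl (intCast_mem_realization hh)
    obtain ⟨v, hv⟩ := Function.ne_iff.1 heq
    obtain ⟨u, hu, hhu⟩ := exists_up_flip hR hh hh' (lt_of_le_of_ne (hle v) hv)
    refine (joinedIn_add_single hh hhu).trans (ih hhu (fun v => ?_) ?_)
    · change h v + (Pi.single u 1 : L.Site → ℤ) v ≤ h' v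
      have : h v ≤ h' v := hle v
      rw [Pi.single_apply]
      split_ifs with hvu
      · subst hvu
        omega
      · omega
    · have hint : u ∈ (M.finite_interior R).toFinset := by
        refine (M.finite_interior R).mem_toFinset.2 ?_
        by_contra hc
        change ¬ M.Interior R u at hc
        rw [hh.1 u hc, hh'.1 u hc] at hu
        exact lt_irrefl _ hu
      simp only [Pi.add_apply, Pi.single_apply, ← sub_sub]
      rw [Finset.sum_sub_distrib, Finset.sum_ite_eq', if_pos hint]
      push_cast at hn
      omega

/-- The realization of the flip complex is closed under minima and contains a path from its maximum
to its minimum; taking minima with the points of this path contracts it. -/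
theorem contractibleSpace_realization (hR : M.NoHoles R) (t₀ : Tiling L R) :
    ContractibleSpace (M.realization t₀) := by
  obtain ⟨m, hm, hmax⟩ := exists_max_height hR t₀
  obtain ⟨b, hb, hmin⟩ := exists_min_height hR t₀
  obtain ⟨γ, hγ⟩ := (joinedIn_of_le hR hb hm (hmin m hm)).symm
  rw [contractible_iff_id_nullhomotopic]
  -- The homotopy takes the minimum with `γ`, which runs from the greatest element (giving the
  -- identity) to the least (giving a constant).
  refine ⟨⟨_, intCast_mem_realization hb⟩, ⟨⟨⟨fun p => ⟨p.2.1 ⊓ γ p.1,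
    inf_mem_realization p.2.2 (hγ p.1)⟩, ?_⟩, fun x => Subtype.ext ?_, fun x => Subtype.ext ?_⟩⟩⟩
  · refine Continuous.subtype_mk (continuous_pi fun v => ?_) _
    exact ((continuous_apply v).comp (continuous_subtype_val.comp continuous_snd)).min
      ((continuous_apply v).comp (γ.continuous.comp continuous_fst))
  · change x.1 ⊓ γ 0 = x.1
    rw [γ.source, inf_eq_left]
    intro v
    by_cases hv : Int.fract (x.1 v) = 0
    · have h1 : ((⌊x.1 v⌋ : ℤ) : ℝ) ≤ m v := Int.cast_le.2 (hmax _ x.2.1 v)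
      have := Int.floor_add_fract (x.1 v)
      linarith
    -- At a nonintegral value the raised floor is still a height, so even the ceiling of `x` is at
    -- most `m`.
    · have h1 := hmax _ (x.2.2 v hv) v
      rw [Pi.add_apply, Pi.single_eq_same] at h1
      have h2 : ((⌊x.1 v⌋ + 1 : ℤ) : ℝ) ≤ m v := Int.cast_le.2 h1
      push_cast at h2
      exact (Int.lt_floor_add_one _).le.trans h2
  · change x.1 ⊓ γ 1 = _
    rw [γ.target]
    refine inf_eq_right.2 fun v => ?_
    exact (Int.cast_le.2 (hmin _ x.2.1 v)).trans (Int.floor_le _)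

theorem contractibleSpace_complex (hR : M.NoHoles R) (t₀ : Tiling L R) :
    ContractibleSpace (Complex L R) :=
  haveI := contractibleSpace_realization hR t₀
  (complexHomeomorph hR t₀).contractibleSpace

end PlanarModel

theorem contractible_and_geodesics_equivalent {L : TileSystem} (M : PlanarModel L)
    (R : Finset L.Face) (hS : SimplyConnectedSpace (carrier L R)) (hT : Nonempty (Tiling L R)) :
    ContractibleSpace (Complex L R) ∧
    (∀ (t t' : Tiling L R) (p q : (flipGraph L R).Walk t t'),
      IsGeodesic p → IsGeodesic q → Equivalent p q) ∧
    (∀ (x : Complex L R) (γ : Path x x), γ.Homotopic (Path.refl x)) := by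
  obtain ⟨t₀⟩ := hT
  have hR : M.NoHoles R := M.noHoles_of_simplyConnected
  have := M.contractibleSpace_complex hR t₀
  exact ⟨this, fun t t' p q hp hq => M.equivalent_of_isGeodesic hR p q hp hq,
    fun x γ => SimplyConnectedSpace.paths_homotopic _ _⟩

end FlipComplex

theorem theorem3p3 (Λ : FlipComplex.Lattice) (R : Finset Λ.system.Face)
    (hR : SimplyConnectedSpace (FlipComplex.carrier Λ.system R))
    (hT : Nonempty (FlipComplex.Tiling Λ.system R)) :
    ContractibleSpace (FlipComplex.Complex Λ.system R) ∧
    (∀ (t t' : FlipComplex.Tiling Λ.system R)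
      (p q : (FlipComplex.flipGraph Λ.system R).Walk t t'),
      FlipComplex.IsGeodesic p → FlipComplex.IsGeodesic q → FlipComplex.Equivalent p q) ∧
    (∀ (x : FlipComplex.Complex Λ.system R) (γ : Path x x), γ.Homotopic (Path.refl x)) := by
  cases Λ with
  | quad => exact FlipComplex.contractible_and_geodesics_equivalent FlipComplex.quadModel R hR hT
  | tri => exact FlipComplex.contractible_and_geodesics_equivalent FlipComplex.triModel R hR hT
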